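/- **Setting.** Let $P$ be a finite set of points in the plane in general position: no two points of $P$ have the same $x$- or the same $y$-coordinate, and no four points of $P$ lie on the boundary of a square (all squares are axis-parallel). Write $d_2$ and $d_\infty$ for the Euclidean and the $L_\infty$-distance. For $u\in P$ let cones $0,1,2,3$ of $u$ be the four open quadrants with apex $u$, in counter-clockwise order starting with the first quadrant; labels are taken modulo $4$. For every $u\in P$ and every cone of $u$ that contains points of $P$ choose one point $w$ of $P$ in that cone at minimum $d_\infty$-distance from $u$, breaking ties arbitrarily, and form the arc $\overrightarrow{uw}$. Let $\overrightarrow{Y}$ be the resulting directed graph and $Y=Y_4^\infty$ the underlying undirected graph on $P$. An edge $(u,v)$ of $Y$ is *uni-directional* if exactly one of $\overrightarrow{uv},\overrightarrow{vu}$ is in $\overrightarrow{Y}$. **Fans.** The *fan* of $u$ in its cone $i$ is the sequence $(u,v_1),\dots,(u,v_k)$, in counter-clockwise order, of all edges of $Y$ incident to $u$ in that cone. An edge $(u,v)$ lying in cone $i$ of $u$ is *mutually-single* if it is the only edge of $Y$ in cone $i$ of $u$ and the only one in cone $i+2$ of $v$; it is *dual* if there are at least two edges of $Y$ in cone $i$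 of $u$ and at least two in cone $i+2$ of $v$. The pairs $(v_l,v_{l+1})$ are the *canonical edges* of $u$ in cone $i$, and $C_u(v_s,v_r)$ is the path from $v_s$ to $v_r$ along the sequence $v_1,\dots,v_k$. It is a *uni-directional canonical path* ending at $v_r$ if each of its edges is uni-directional and oriented from $v_s$ towards $v_r$; it is maximal if it is contained in no other such path ending at $v_r$. **Anchors.** If $(u,v)$ is mutually-single and lies in cone $i$ of $u$, then $\mathrm{anchor}_i(u)=(u,v)$. If $k\ge2$, let $\overrightarrow{uv_l}$ be the unique arc of $\overrightarrow{Y}$ out of $u$ in cone $i$. (i) If $l\ge 2$ and $(v_{l-1},v_l)$ is uni-directional with $\overrightarrow{v_{l-1}v_l}\in\overrightarrow{Y}$, then $\mathrm{anchor}_i(u)=(u,v_{l'})$ where $l'<l$ and $C_u(v_{l'},v_l)$ is a maximal uni-directional canonical path ending at $v_l$. (ii) Otherwise, if $l\le k-1$ and $(v_{l+1},v_l)$ is uni-directional with $\overrightarrow{v_{l+1}v_l}\in\overrightarrow{Y}$, the same with $l'>l$. (iii) Otherwise $\mathrm{anchor}_i(u)=(u,v_l)$. In all other cases $\mathrm{anchor}_i(u)$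 is undefined. An anchor $\mathrm{anchor}_i(u)=(u,v)$ is *strong* if $\mathrm{anchor}_{i+2}(v)$ is undefined or equal to $(v,u)$, and *weak* otherwise. A *weak anchor chain* is a path $w_0,\dots,w_k$ ($k\ge1$) of maximal length consisting of weak anchors $\mathrm{anchor}_i(w_0)=(w_0,w_1)$, $\mathrm{anchor}_{i+2}(w_1)=(w_1,w_2)$, $\mathrm{anchor}_i(w_2)=(w_2,w_3)$, …, and ending when the anchor of $w_k$ in cone $i$ ($k$ even) or $i+2$ ($k$ odd) is strong. All strong anchors are *selected*, and in each weak anchor chain the anchors $(w_{l-1},w_l)$ chosen by $w_{l-1}$, for $l=k-1,k-3,\dots\ge1$, are selected. If $k$ is odd, $(w_0,w_1)$ is a *start-of-odd-chain anchor* chosen by $w_0$. **The graph $H_8$.** It consists of all selected anchors and, for every fan $(u,v_1),\dots,(u,v_k)$ with $k\ge2$ in a cone of a point $u$, all uni-directional edges on $C_u(v_1,v_k)$, with two exceptions: (a) $(v_2,v_1)$ is not chosen if $(v_1,u)$ is dual but is not a start-of-odd-chain anchor chosen by $v_1$, and $(v_2,v_1)$ is not an anchor, $\overrightarrow{v_2v_1}\in\overrightarrow{Y}$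 and $\overrightarrow{v_1v_2}\notin\overrightarrow{Y}$; (b) $(v_{k-1},v_k)$ is not chosen if $(v_k,u)$ is dual but is not a start-of-odd-chain anchor chosen by $v_k$, and $(v_{k-1},v_k)$ is not an anchor, $\overrightarrow{v_{k-1}v_k}\in\overrightarrow{Y}$ and $\overrightarrow{v_kv_{k-1}}\notin\overrightarrow{Y}$. **Standard paths.** Let $(u,v)\in Y$ lie in cone $i$ of $u$ and let $\mathrm{anchor}_i(u)=(u,v')$ be defined. The *1-standard path* from $u$ to $v$ consists of $(u,v')$ and $C_u(v',v)$. The *2-standard path* from $u$ to $v$ is the 1-standard path from $u$ to $v$ if $\mathrm{anchor}_i(u)$ is selected; otherwise it consists of $C_u(v,v')$ and the 1-standard path from $v'$ to $u$. For $d\ge1$, a *$2d$-standard pre-path in $H_8$* from $u$ to $v$ consists of all edges of the 2-standard path $p$ from $u$ to $v$ that are in $H_8$ and, if $d>1$, for every canonical edge $(w,w')$ of $p$ not in $H_8$, a $2(d-1)$-standard pre-path in $H_8$ from $w$ to $w'$ or from $w'$ to $w$, put in the place of $(w,w')$. If it is a path from $u$ to $v$ in $H_8$ (i.e. its edges, in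 this order, lead without gaps from $u$ to $v$), it is called a *$2d$-standard path* in $H_8$. The length of a path is the sum of the Euclidean lengths of its edges, with multiplicity. **Theorem.** For every edge $(u,v)$ of $Y_4^\infty$ there is a $6$-standard path in $H_8$ from $u$ to $v$ or from $v$ to $u$ of length at most $(3+\sqrt2)^6\, d_2(u,v)$. Consequently $H_8$ is a $(3+\sqrt2)^6$-spanner of $Y_4^\infty$: it is a subgraph of $Y_4^\infty$, and for any two points $u,v\in P$ the distance from $u$ to $v$ in $H_8$ (the length of a shortest path) is at most $(3+\sqrt2)^6$ times their distance in $Y_4^\infty$. -/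

import Mathlib

open scoped ENNReal

noncomputable section

namespace YaoSpanner

/-- The Euclidean plane; `dist` is the Euclidean distance `d₂`. -/
abbrev Pt : Type := EuclideanSpace ℝ (Fin 2)

/-- The `L_∞`-distance. -/
def dInf (u v : Pt) : ℝ := max |u 0 - v 0| |u 1 - v 1|

/-- `v` lies in the open cone (quadrant) `i` of `u`; the cones are numbered counter-clockwise,
starting with the first quadrant. Arithmetic on the labels is that of `Fin 4`, i.e. modulo 4. -/
def InCone (i : Fin 4) (u v : Pt) : Prop :=
  match i with
  | 0 => u 0 < v 0 ∧ u 1 < v 1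
  | 1 => v 0 < u 0 ∧ u 1 < v 1
  | 2 => v 0 < u 0 ∧ v 1 < u 1
  | 3 => u 0 < v 0 ∧ v 1 < u 1

/-- General position: no two points share a coordinate, and no four points lie on the boundary of
an axis-parallel square (the boundary of the square with centre `c` and side `2 r` is the set of
points at `L_∞`-distance exactly `r` from `c`). -/
def GeneralPosition (P : Finset Pt) : Prop :=
  (∀ u ∈ P, ∀ v ∈ P, u ≠ v → u 0 ≠ v 0 ∧ u 1 ≠ v 1) ∧
  (∀ (c : Pt) (r : ℝ), 0 < r → {p : Pt | p ∈ P ∧ dInf c p = r}.ncard ≤ 3)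

variable {P : Finset Pt}

/-- `D` is a directed Yao graph on `P`: in each non-empty cone of each node `u`, exactly one arc
out of `u` is chosen, its head is `L_∞`-nearest to `u` among the points of that cone (ties are
broken arbitrarily), and there are no other arcs. -/
structure IsYaoDigraph (D : P → P → Prop) : Prop where
  choice : ∀ (u : P) (i : Fin 4), (∃ w : P, InCone i u w) → ∃! w : P, InCone i u w ∧ D u w
  nearest : ∀ u v : P, D u v →
    ∃ i : Fin 4, InCone i u v ∧ ∀ w : P, InCone i u w → dInf u v ≤ dInf u w

/-- The undirected Yao graph underlying `D`. -/
def yaoGraph (D : P → P → Prop) : SimpleGraph P := SimpleGraph.fromRel D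

/-- The edge `(a, b)` is uni-directional with orientation from `a` to `b`. -/
def UniArc (D : P → P → Prop) (a b : P) : Prop := D a b ∧ ¬ D b a

/-! ### Fans and canonical edges -/

/-- `(u, v)` is an edge of the Yao graph lying in cone `i` of `u`, i.e. an edge of the fan of `u`
in its cone `i`. -/
def FanMem (D : P → P → Prop) (i : Fin 4) (u v : P) : Prop :=
  (yaoGraph D).Adj u v ∧ InCone i u v

/-- For `a`, `b` in a common cone of `u`: `(u, b)` is strictly counter-clockwise from `(u, a)`. -/
def Ccw (u a b : Pt) : Prop :=
  0 < (a 0 - u 0) * (b 1 - u 1) - (a 1 - u 1) * (b 0 - u 0)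

/-- `(u, a)` and `(u, b)` are consecutive, in counter-clockwise order, in the fan of `u` in its
cone `i`: `a = v_l` and `b = v_{l+1}` for some `l`. -/
def FanNext (D : P → P → Prop) (i : Fin 4) (u a b : P) : Prop :=
  FanMem D i u a ∧ FanMem D i u b ∧ Ccw u a b ∧
    ∀ c : P, FanMem D i u c → ¬ (Ccw u a c ∧ Ccw u c b)

/-- `(u, a)` comes first in the fan of `u` in its cone `i`. -/
def FanFirst (D : P → P → Prop) (i : Fin 4) (u a : P) : Prop :=
  FanMem D i u a ∧ ∀ c : P, FanMem D i u c → ¬ Ccw u c a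

/-- `(u, a)` comes last in the fan of `u` in its cone `i`. -/
def FanLast (D : P → P → Prop) (i : Fin 4) (u a : P) : Prop :=
  FanMem D i u a ∧ ∀ c : P, FanMem D i u c → ¬ Ccw u a c

/-- The fan of `u` in its cone `i` has two or more edges. -/
def FanMulti (D : P → P → Prop) (i : Fin 4) (u : P) : Prop :=
  ∃ a b : P, a ≠ b ∧ FanMem D i u a ∧ FanMem D i u b

/-- `(u, v)`, lying in cone `i` of `u`, is a mutually-single edge. -/
def MutuallySingle (D : P → P → Prop) (i : Fin 4) (u v : P) : Prop :=
  FanMem D i u v ∧ ¬ FanMulti D i u ∧ ¬ FanMulti D (i + 2) v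

/-- `(u, v)`, lying in cone `i` of `u`, is a dual edge. -/
def DualEdge (D : P → P → Prop) (i : Fin 4) (u v : P) : Prop :=
  FanMem D i u v ∧ FanMulti D i u ∧ FanMulti D (i + 2) v

/-- `(a, b)` is a canonical edge (of some node `u`, in some cone `i` of `u`). -/
def Canonical (D : P → P → Prop) (a b : P) : Prop :=
  ∃ (i : Fin 4) (u : P), FanNext D i u a b ∨ FanNext D i u b a

/-- `p` is the path from `s` to `r` along the fan of `u` in its cone `i`, in whichever direction
leads from `s` to `r`. -/
def CanPath (D : P → P → Prop) (i : Fin 4) (u s r : P) (p : List P) : Prop :=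
  FanMem D i u s ∧ FanMem D i u r ∧ p.head? = some s ∧ p.getLast? = some r ∧
    (p.IsChain (fun a b => FanNext D i u a b) ∨ p.IsChain (fun a b => FanNext D i u b a))

/-- `p` is a uni-directional canonical path from `s` to `r`. -/
def UniCanPath (D : P → P → Prop) (i : Fin 4) (u s r : P) (p : List P) : Prop :=
  CanPath D i u s r p ∧ p.IsChain (UniArc D)

/-- `p` is a maximal uni-directional canonical path ending at `r`, and starts at `s`. -/
def MaxUniCanPath (D : P → P → Prop) (i : Fin 4) (u s r : P) (p : List P) : Prop :=
  UniCanPath D i u s r p ∧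
    ∀ (s' : P) (p' : List P), UniCanPath D i u s' r p' → p <:+ p' → p' = p

/-! ### Anchors -/

/-- For `t = v_l` in the fan of `u`: `l ≥ 2` and `(v_{l-1}, v_l)` is uni-directional, oriented
towards `v_l`. -/
def UniFromPrev (D : P → P → Prop) (i : Fin 4) (u t : P) : Prop :=
  ∃ a : P, FanNext D i u a t ∧ UniArc D a t

/-- For `t = v_l` in the fan of `u`: `l ≤ k - 1` and `(v_{l+1}, v_l)` is uni-directional, oriented
towards `v_l`. -/
def UniFromNext (D : P → P → Prop) (i : Fin 4) (u t : P) : Prop :=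
  ∃ b : P, FanNext D i u t b ∧ UniArc D b t

/-- `(u, v)` is the anchor chosen by `u` in its cone `i`. In the second case `t` is the head of the
arc out of `u` in cone `i`. -/
def IsAnchor (D : P → P → Prop) (i : Fin 4) (u v : P) : Prop :=
  MutuallySingle D i u v ∨
  (FanMulti D i u ∧ ∃ t : P, InCone i u t ∧ D u t ∧
    ((UniFromPrev D i u t ∧ Ccw u v t ∧ ∃ p : List P, MaxUniCanPath D i u v t p) ∨
     (¬ UniFromPrev D i u t ∧ UniFromNext D i u t ∧
        Ccw u t v ∧ ∃ p : List P, MaxUniCanPath D i u v t p) ∨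
     (¬ UniFromPrev D i u t ∧ ¬ UniFromNext D i u t ∧ v = t)))

/-- `(u, v)` is an anchor (chosen by `u` or by `v`). -/
def AnchorEdge (D : P → P → Prop) (u v : P) : Prop :=
  ∃ i : Fin 4, IsAnchor D i u v ∨ IsAnchor D i v u

/-- `(u, v)` is a strong anchor chosen by `u` in its cone `i`: the anchor of `v` in its cone
`i + 2` is `(v, u)` or is not defined. -/
def StrongAnchor (D : P → P → Prop) (i : Fin 4) (u v : P) : Prop :=
  IsAnchor D i u v ∧ ∀ w : P, IsAnchor D (i + 2) v w → w = u

/-- `(u, v)` is a weak anchor chosen by `u` in its cone `i`: the anchor of `v` in its cone `i + 2`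
is defined and is not `(v, u)`. -/
def WeakAnchor (D : P → P → Prop) (i : Fin 4) (u v : P) : Prop :=
  IsAnchor D i u v ∧ ∃ w : P, IsAnchor D (i + 2) v w ∧ w ≠ u

/-- The cones `i, i + 2, i, i + 2, …`. -/
def altCone (i : Fin 4) (l : ℕ) : Fin 4 := if Even l then i else i + 2

/-- `w 0, …, w k` is a weak anchor chain (with `k ≥ 1` weak anchors, the first one in cone `i` of
`w 0`): it runs until the anchor of `w k` is strong, and cannot be extended backwards.
(The values `w l` with `k < l` are irrelevant.) -/
structure IsWeakChain (D : P → P → Prop) (i : Fin 4) (k : ℕ) (w : ℕ → P) : Prop where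
  pos : 1 ≤ k
  weak : ∀ l < k, WeakAnchor D (altCone i l) (w l) (w (l + 1))
  term : ∃ z : P, StrongAnchor D (altCone i k) (w k) z
  start : ∀ z : P, ¬ WeakAnchor D (i + 2) z (w 0)

/-- `(u, v)` is a selected anchor chosen by `u` in its cone `i`: a strong anchor, or one of the
anchors `(w_{l-1}, w_l)` with `l = k - 1, k - 3, … ≥ 1` of a weak anchor chain (here `n = l - 1`). -/
def SelectedAnchor (D : P → P → Prop) (i : Fin 4) (u v : P) : Prop :=
  StrongAnchor D i u v ∨
  ∃ (j : Fin 4) (k : ℕ) (w : ℕ → P), IsWeakChain D j k w ∧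
    ∃ n m : ℕ, n + 2 + 2 * m = k ∧ i = altCone j n ∧ u = w n ∧ v = w (n + 1)

/-- `(u, v)` is a start-of-odd-chain anchor chosen by `u` in its cone `i`. -/
def StartOfOddChain (D : P → P → Prop) (i : Fin 4) (u v : P) : Prop :=
  ∃ (k : ℕ) (w : ℕ → P), IsWeakChain D i k w ∧ Odd k ∧ u = w 0 ∧ v = w 1

/-! ### The graph `H₈` -/

/-- Exception at the first edge of a fan: `a = v₁` and `b = v₂` in the fan of `u` in cone `i`. -/
def ExceptFirst (D : P → P → Prop) (i : Fin 4) (u a b : P) : Prop :=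
  FanNext D i u a b ∧ FanFirst D i u a ∧ DualEdge D i u a ∧ ¬ StartOfOddChain D (i + 2) a u ∧
    ¬ AnchorEdge D a b ∧ UniArc D b a

/-- Exception at the last edge of a fan: `a = v_{k-1}` and `b = v_k` in the fan of `u` in
cone `i`. -/
def ExceptLast (D : P → P → Prop) (i : Fin 4) (u a b : P) : Prop :=
  FanNext D i u a b ∧ FanLast D i u b ∧ DualEdge D i u b ∧ ¬ StartOfOddChain D (i + 2) b u ∧
    ¬ AnchorEdge D a b ∧ UniArc D a b

/-- `(a, b)` is a uni-directional canonical edge of `u` in its cone `i` (with `b` the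
counter-clockwise successor of `a`) that is chosen for `H₈`. -/
def ChosenCanonical (D : P → P → Prop) (i : Fin 4) (u a b : P) : Prop :=
  FanNext D i u a b ∧ (UniArc D a b ∨ UniArc D b a) ∧
    ¬ ExceptFirst D i u a b ∧ ¬ ExceptLast D i u a b

/-- `H₈`: all selected anchors and all chosen uni-directional canonical edges (as undirected
edges; `SimpleGraph.fromRel` symmetrizes). -/
def H8 (D : P → P → Prop) : SimpleGraph P :=
  SimpleGraph.fromRel fun a b =>
    (∃ i : Fin 4, SelectedAnchor D i a b) ∨ ∃ (i : Fin 4) (u : P), ChosenCanonical D i u a b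

/-! ### Standard paths -/

/-- `p` is the `1`-standard path from `u` to `v`. -/
def OneStandard (D : P → P → Prop) (u v : P) (p : List P) : Prop :=
  ∃ (i : Fin 4) (v' : P) (q : List P), FanMem D i u v ∧ IsAnchor D i u v' ∧
    CanPath D i u v' v q ∧ p = u :: q

/-- `p` is the `2`-standard path from `u` to `v`. If the anchor `(u, v')` is not selected, it
consists of the canonical path `q` from `v` to `v'` followed by the `1`-standard path `r` from `v'`
to `u`, read backwards. -/
def TwoStandard (D : P → P → Prop) (u v : P) (p : List P) : Prop :=
  ∃ (i : Fin 4) (v' : P), FanMem D i u v ∧ IsAnchor D i u v' ∧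
    ((SelectedAnchor D i u v' ∧ OneStandard D u v p) ∨
     (¬ SelectedAnchor D i u v' ∧ ∃ q r : List P, CanPath D i u v v' q ∧ OneStandard D v' u r ∧
        p = (q ++ r.tail).reverse))

/-- Replace every edge `(a, b)` of a path, given by its list of nodes, by a list `E` of directed
edges with `B a b E`, and concatenate these lists. -/
inductive Splice (B : P → P → List (P × P) → Prop) : List P → List (P × P) → Prop
  | single (a : P) : Splice B [a] []
  | cons (a b : P) (p : List P) (E F : List (P × P)) :
      B a b E → Splice B (b :: p) F → Splice B (a :: b :: p) (E ++ F)

/-- The list of edges `E`, traversed in the opposite direction. -/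
def reverseEdges (E : List (P × P)) : List (P × P) := (E.map Prod.swap).reverse

/-- `E` is a `2d`-standard pre-path in `H` from `u` to `v` (`d ≥ 1`), as the list of its edges in
the order in which they are traversed: on the `2`-standard path from `u` to `v`, an edge in `H` is
kept; a canonical edge `(a, b)` not in `H` is replaced, if `d > 1`, by a `2(d-1)`-standard pre-path
from `a` to `b` or from `b` to `a`; any other edge not in `H` is dropped. -/
def PrePath (D : P → P → Prop) (H : SimpleGraph P) : ℕ → P → P → List (P × P) → Prop
  | 0, _, _, _ => False
  | d + 1, u, v, E => ∃ p : List P, TwoStandard D u v p ∧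
      Splice (fun a b F =>
        (H.Adj a b ∧ F = [(a, b)]) ∨
        (¬ H.Adj a b ∧ Canonical D a b ∧ 1 ≤ d ∧
          (PrePath D H d a b F ∨ PrePath D H d b a (reverseEdges F))) ∨
        (¬ H.Adj a b ∧ ¬ (Canonical D a b ∧ 1 ≤ d) ∧ F = [])) p E

/-- The list of directed edges `E` is a path from `u` to `v` in `H`. -/
def IsPathIn (H : SimpleGraph P) (u v : P) (E : List (P × P)) : Prop :=
  ∃ w : H.Walk u v, w.darts.map (fun e => e.toProd) = E

/-- `E` is a `2d`-standard path in `H` from `u` to `v`: a `2d`-standard pre-path in `H` from `u` to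
`v` that is a path from `u` to `v`. -/
def IsStandardPath (D : P → P → Prop) (H : SimpleGraph P) (d : ℕ) (u v : P)
    (E : List (P × P)) : Prop :=
  PrePath D H d u v E ∧ IsPathIn H u v E

/-- The Euclidean length of a list of edges. -/
def edgesLength (E : List (P × P)) : ℝ := (E.map fun e => dist e.1 e.2).sum

/-! ### Spanners -/

/-- The distance between `u` and `v` in the graph `G` with Euclidean edge lengths (`∞` if they are
not connected). -/
def graphDist (G : SimpleGraph P) (u v : P) : ℝ≥0∞ :=
  ⨅ w : G.Walk u v, ENNReal.ofReal (edgesLength (w.darts.map fun e => e.toProd))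

/-- `H` is a `t`-spanner of `G`. -/
def IsSpanner (t : ℝ) (H G : SimpleGraph P) : Prop :=
  1 ≤ t ∧ H ≤ G ∧ ∀ u v : P, graphDist H u v ≤ ENNReal.ofReal t * graphDist G u v

end YaoSpanner

end

noncomputable section

namespace YaoSpanner

variable {P : Finset Pt} {D : P → P → Prop}

/-! The length of a pre-path and its being connected are separate matters.

Length. Put K = 3 + √2. Let (u, v') be the anchor of u in the cone of v, let t be the head of the
arc out of u there, and take u as origin. By nearness both coordinates of t are at most d₂(u, v).
The canonical edges from v' to t are uni-directional, so on each of them the growing coordinate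
changes by more than the shrinking one: the coordinate sum of v' is at most that of t, and each such
edge is at most √2 times its growth. The fan is a staircase, so the lengths of the other canonical
edges telescope. Hence a 1-standard path has length at most K d₂(u, v) (`anchor_path_le`), a
2-standard path at most K² d₂(u, v), and every level of replacement contributes a further K²
(`PrePath.length_le`). Three levels give K⁶.

Geometry. The box spanned by an edge and the rectangle spanned by two consecutive fan members are
empty. Therefore consecutive members are joined by an arc (`Frame.arc`), only the extreme edges of a
fan can be dual (`single_of_between`), a canonical edge is extreme in the fans of its ends and
cannot be dual (`OrNext.opposite_single`), and the tail of a uni-directional canonical edge has no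
other edge in its cone (`Frame.uni_single`). Weak anchors cannot follow each other forever
(`no_infinite_weak`), so an anchor that is not selected is followed by a selected one.

Connectedness. A bi-directional canonical edge (u, e) that is not alone at u is alone at e. If it is
not itself the anchor of u, both canonical segments of its 2-standard path end at the head of an arc
out of their apex and are thus uni-directional; neither exception in H₈ applies to them, because e
has a single opposite edge, no uni-directional edge enters an extreme anchor, and an anchor of u
that is not selected starts an odd chain. So depth 1 suffices. An excepted uni-directional edge,
taken from its head, is alone at its tail; the same reasoning leaves on its segments only edges of
H₈ and bi-directional edges, so depth 2 suffices. An arbitrary edge has an anchor at one of its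
ends, and the segments consist of canonical edges: depth 3. -/

/-! ### Frames: the geometry of one quadrant -/

/-- The Yao property of `D` for the quadrant in which both `x` and `y` increase. -/
structure Quad (D : P → P → Prop) (x y : P → ℝ) : Prop where
  -- The inequality between two maxima of extents, split into disjunctions so that linear arithmetic
  -- applies.
  near : ∀ u v w : P, D u v → x u < x v → y u < y v → x u < x w → y u < y w →
    (x v - x u ≤ x w - x u ∨ x v - x u ≤ y w - y u) ∧
    (y v - y u ≤ x w - x u ∨ y v - y u ≤ y w - y u)
  uniq : ∀ u v w : P, D u v → D u w → x u < x v → y u < y v → x u < x w → y u < y w → v = w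
  exist : ∀ u w : P, x u < x w → y u < y w → ∃ v, D u v ∧ x u < x v ∧ y u < y v

/-- A pair of axis-parallel coordinates for which `D` has the Yao property in all quadrants. -/
structure Frame (D : P → P → Prop) (x y : P → ℝ) : Prop where
  injx : ∀ u v : P, x u = x v → u = v
  injy : ∀ u v : P, y u = y v → u = v
  pp : Quad D x y
  np : Quad D (-x) y
  pn : Quad D x (-y)
  nn : Quad D (-x) (-y)

variable {x y : P → ℝ}

theorem Quad.swap (h : Quad D x y) : Quad D y x where
  near u v w h1 h2 h3 h4 h5 := by
    obtain ⟨ha, hb⟩ := h.near u v w h1 h3 h2 h5 h4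
    exact ⟨hb.symm, ha.symm⟩
  uniq u v w h1 h2 h3 h4 h5 h6 := h.uniq u v w h1 h2 h4 h3 h6 h5
  exist u w h1 h2 := by
    obtain ⟨v, a, b, c⟩ := h.exist u w h2 h1
    exact ⟨v, a, c, b⟩

theorem Frame.swap (F : Frame D x y) : Frame D y x :=
  ⟨F.injy, F.injx, F.pp.swap, F.pn.swap, F.np.swap, F.nn.swap⟩

theorem Frame.negx (F : Frame D x y) : Frame D (-x) y :=
  ⟨fun u v h => F.injx u v (by simpa using h), F.injy, F.np, by simpa using F.pp, F.nn,
    by simpa using F.pn⟩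

theorem Frame.negy (F : Frame D x y) : Frame D x (-y) := F.swap.negx.swap

/-- The quadrant is non-empty, so some arc leaves `u` in it; a head other than `v` would be at least
as near as `v`, which `hmin` forbids. Ties need no separate treatment, since `hmin` excludes them
too. -/
theorem Quad.forced (h : Quad D x y) {u v : P} (hx : x u < x v) (hy : y u < y v)
    (hmin : ∀ w, x u < x w → y u < y w → w ≠ v →
      ¬ (x w - x u ≤ max (x v - x u) (y v - y u) ∧ y w - y u ≤ max (x v - x u) (y v - y u))) :
    D u v := by
  obtain ⟨w, h1, h2, h3⟩ := h.exist u v hx hy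
  by_cases hw : w = v
  · exact hw ▸ h1
  · exfalso
    refine hmin w h2 h3 hw ?_
    simpa [le_max_iff] using h.near u w v h1 h2 h3 hx hy

theorem Frame.near_nn (F : Frame D x y) {u v w : P} (h : D v u) (h1 : x u < x v) (h2 : y u < y v)
    (h3 : x w < x v) (h4 : y w < y v) :
    (x v - x u ≤ x v - x w ∨ x v - x u ≤ y v - y w) ∧
    (y v - y u ≤ x v - x w ∨ y v - y u ≤ y v - y w) := by
  have := F.nn.near v u w h (by simpa) (by simpa) (by simpa) (by simpa)
  simpa only [Pi.neg_apply, neg_sub_neg] using this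

theorem Frame.near_np (F : Frame D x y) {u v w : P} (h : D u v) (h1 : x v < x u) (h2 : y u < y v)
    (h3 : x w < x u) (h4 : y u < y w) :
    (x u - x v ≤ x u - x w ∨ x u - x v ≤ y w - y u) ∧
    (y v - y u ≤ x u - x w ∨ y v - y u ≤ y w - y u) := by
  have := F.np.near u v w h (by simpa) (by simpa) (by simpa) (by simpa)
  simpa only [Pi.neg_apply, neg_sub_neg] using this

theorem Frame.near_pn (F : Frame D x y) {u v w : P} (h : D u v) (h1 : x u < x v) (h2 : y v < y u)
    (h3 : x u < x w) (h4 : y w < y u) :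
    (x v - x u ≤ x w - x u ∨ x v - x u ≤ y u - y w) ∧
    (y u - y v ≤ x w - x u ∨ y u - y v ≤ y u - y w) := by
  have := F.pn.near u v w h (by simpa) (by simpa) (by simpa) (by simpa)
  simpa only [Pi.neg_apply, neg_sub_neg] using this

/-- `(u, v)` is an edge of the Yao graph with `v` in the quadrant of `u` in which `x` and `y`
increase. -/
def FEdge (D : P → P → Prop) (x y : P → ℝ) (u v : P) : Prop :=
  x u < x v ∧ y u < y v ∧ (D u v ∨ D v u)

theorem FEdge.swap {u v : P} (h : FEdge D x y u v) : FEdge D y x u v := ⟨h.2.1, h.1, h.2.2⟩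

/-- The box spanned by an edge is empty. -/
theorem Frame.box (F : Frame D x y) {u a w : P} (ha : FEdge D x y u a) (h1 : x u < x w)
    (h2 : y u < y w) (h3 : x w < x a) (h4 : y w < y a) : False := by
  obtain ⟨hx, hy, h | h⟩ := ha
  · obtain ⟨h5 | h5, h6 | h6⟩ := F.pp.near u a w h hx hy h1 h2 <;> linarith
  · obtain ⟨h5 | h5, h6 | h6⟩ := F.near_nn (w := w) h hx hy h3 h4 <;> linarith

/-- Of two comparable fan members, the smaller would lie in the box spanned by the larger. -/
theorem Frame.staircase (F : Frame D x y) {u a b : P} (ha : FEdge D x y u a)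
    (hb : FEdge D x y u b) (hab : a ≠ b) :
    (x b < x a ∧ y a < y b) ∨ (x a < x b ∧ y b < y a) := by
  rcases lt_trichotomy (x a) (x b) with h | h | h
  · rcases lt_trichotomy (y a) (y b) with h' | h' | h'
    · exact (F.box hb ha.1 ha.2.1 h h').elim
    · exact (hab (F.injy _ _ h')).elim
    · exact Or.inr ⟨h, h'⟩
  · exact (hab (F.injx _ _ h)).elim
  · rcases lt_trichotomy (y a) (y b) with h' | h' | h'
    · exact Or.inl ⟨h, h'⟩
    · exact (hab (F.injy _ _ h')).elim
    · exact (F.box ha hb.1 hb.2.1 h h').elim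

theorem Frame.staircase_iff (F : Frame D x y) {u a b : P} (ha : FEdge D x y u a)
    (hb : FEdge D x y u b) : x b < x a ↔ y a < y b := by
  by_cases hab : a = b
  · subst hab; simp
  · rcases F.staircase ha hb hab with h | h
    · exact ⟨fun _ => h.2, fun _ => h.1⟩
    · exact ⟨fun h' => by linarith, fun h' => by linarith⟩

/-- If `y` is at most the `x`-extent, no point below the `x`-axis competes with `u` for `c`. -/
theorem Frame.below (F : Frame D x y) {u a c w : P} (ha : FEdge D x y u a) (hca : x c < x a)
    (hac : y a < y c) (hcx : x u < x c) (_ : y c - y u ≤ x c - x u) (h1 : x u < x w)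
    (h2 : y w < y u) (h3 : x w < x c) (h4 : y c - y w ≤ x c - x u) : False := by
  obtain ⟨hx, hy, h | h⟩ := ha
  -- For an arc from `u` to `a`, the point `c` is nearer to `u` than `a`; for an arc from `a` to
  -- `u`, the point `w` is nearer to `a` than `u`.
  · obtain ⟨h5 | h5, h6 | h6⟩ := F.pp.near u a c h hx hy hcx (by linarith) <;> linarith
  · obtain ⟨h5 | h5, h6 | h6⟩ :=
      F.near_nn (w := w) h hx hy (by linarith) (by linarith) <;> linarith

/-- The rectangle between two consecutive members of a fan is empty. -/
theorem Frame.rect_empty (F : Frame D x y) {u a b : P} (ha : FEdge D x y u a)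
    (hb : FEdge D x y u b) (hx : x b < x a) (hy : y a < y b)
    (hcons : ∀ c, FEdge D x y u c → ¬ (x b < x c ∧ x c < x a)) (c : P)
    (h1 : x b < x c) (h2 : x c < x a) (h3 : y a < y c) (h4 : y c < y b) : False := by
  classical
  -- A point of the rectangle with least coordinate sum must send its arc to `u`, and so is a fan
  -- member strictly between `a` and `b`.
  obtain ⟨c, hcS, hmin⟩ := Set.exists_min_image
    {c : P | x b < x c ∧ x c < x a ∧ y a < y c ∧ y c < y b} (fun c => x c + y c)
    (Set.toFinite _) ⟨c, h1, h2, h3, h4⟩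
  obtain ⟨h1, h2, h3, h4⟩ := hcS
  have hux := ha.1; have huy := ha.2.1; have hbx := hb.1; have hby := hb.2.1
  refine hcons c ⟨by linarith, by linarith, Or.inr ?_⟩ ⟨h1, h2⟩
  refine F.nn.forced (by simp; linarith) (by simp; linarith) ?_
  intro w hw1 hw2 hwu ⟨h5, h6⟩
  simp only [Pi.neg_apply, neg_lt_neg_iff, neg_sub_neg] at hw1 hw2 h5 h6
  rcases lt_trichotomy (x w) (x u) with hxw | hxw | hxw
  · rcases le_total (y c - y u) (x c - x u) with hm | hm
    · rw [max_eq_left hm] at h5; linarith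
    · rw [max_eq_right hm] at h5 h6
      rcases lt_trichotomy (y w) (y u) with hyw | hyw | hyw
      · linarith
      · exact hwu (F.injy _ _ hyw)
      · exact F.swap.below hb.swap h4 h1 (by linarith) hm hyw hxw hw2 h5
  · exact hwu (F.injx _ _ hxw)
  · rcases lt_trichotomy (y w) (y u) with hyw | hyw | hyw
    · rcases le_total (y c - y u) (x c - x u) with hm | hm
      · rw [max_eq_left hm] at h5 h6
        exact F.below ha h2 h3 (by linarith) hm hxw hyw hw1 h6
      · rw [max_eq_right hm] at h6; linarith
    · exact hwu (F.injy _ _ hyw)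
    -- A competitor inside the quadrant of `u` avoids the boxes of `a` and `b`, so it lies in the
    -- rectangle and has a smaller coordinate sum than `c`.
    · have hb' : x b < x w := by
        rcases lt_trichotomy (x w) (x b) with h | h | h
        · exact (F.box hb hxw hyw h (by linarith)).elim
        · have := F.injx _ _ h; subst this; linarith
        · exact h
      have ha' : y a < y w := by
        rcases lt_trichotomy (y w) (y a) with h | h | h
        · exact (F.box ha hxw hyw (by linarith) h).elim
        · have := F.injy _ _ h; subst this; linarith
        · exact h
      have := hmin w ⟨hb', by linarith, ha', by linarith⟩
      linarith

/-- Consecutive members of a fan are joined by an arc, whose direction is determined by the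
longer side of the rectangle they span. -/
theorem Frame.arc (F : Frame D x y) {u a b : P} (ha : FEdge D x y u a)
    (hb : FEdge D x y u b) (hx : x b < x a) (hy : y a < y b)
    (hcons : ∀ c, FEdge D x y u c → ¬ (x b < x c ∧ x c < x a))
    (hle : y b - y a ≤ x a - x b) : D b a := by
  have hux := ha.1; have huy := ha.2.1; have hbx := hb.1; have hby := hb.2.1
  refine F.pn.forced hx (by simpa using hy) ?_
  intro e he1 he2 hea ⟨h5, h6⟩
  simp only [Pi.neg_apply, neg_lt_neg_iff, neg_sub_neg] at he2 h5 h6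
  rw [max_eq_left hle] at h5 h6
  have hxe : x e < x a := lt_of_le_of_ne (by linarith) fun h => hea (F.injx _ _ h)
  have hye : y e < y a := by
    rcases lt_trichotomy (y e) (y a) with h | h | h
    · exact h
    · exact (hea (F.injy _ _ h)).elim
    · exact (F.rect_empty ha hb hx hy hcons e he1 hxe h he2).elim
  have hyu : y e < y u := by
    rcases lt_trichotomy (y e) (y u) with h | h | h
    · exact h
    · have := F.injy _ _ h; subst this; linarith
    · exact (F.box ha (by linarith) h hxe hye).elim
  -- Since `e` is below `u` and `y b - y e ≤ x a - x b < x a - x u`, the point `b` is nearer to `u`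
  -- than `a`, and `e` is nearer to `a` than `u`: neither direction of the arc between `u` and `a`
  -- is possible.
  obtain ⟨-, -, h | h⟩ := ha
  · obtain ⟨h5 | h5, h6 | h6⟩ := F.pp.near u a b h hux huy hbx hby <;> linarith
  · obtain ⟨h5 | h5, h6 | h6⟩ := F.near_nn (w := e) h hux huy hxe hye <;> linarith

/-- If `a` precedes `b` in the fan of `u`, then no edge of `b` towards `a`'s side enters the
triangle `u`, `a`, `b`. -/
theorem Frame.first_side (F : Frame D x y) {u a b e : P} (ha : FEdge D x y u a)
    (hb : FEdge D x y u b) (hx : x b < x a) (hy : y a < y b) (he : FEdge D x (-y) b e)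
    (hxe : x e < x a) (hye : y e < y a) : False := by
  have hux := ha.1; have huy := ha.2.1; have hbx := hb.1; have hby := hb.2.1
  obtain ⟨he1, he2, he⟩ := he
  simp only [Pi.neg_apply, neg_lt_neg_iff] at he2
  have hyu : y e < y u := by
    rcases lt_trichotomy (y e) (y u) with h | h | h
    · exact h
    · have := F.injy _ _ h; subst this; linarith
    · exact (F.box ha (by linarith) h hxe hye).elim
  -- The two cases are the directions of the edge between `b` and `e`: its tail compares it with `a`
  -- or with `u`. Both bounds are below `x a - x u`, which makes `b` too near to `u` and `e` too
  -- near to `a`.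
  have key : y b - y e ≤ x a - x b ∨ y b - y e ≤ x e - x u := by
    rcases he with he | he
    · obtain ⟨-, h6 | h6⟩ := F.near_pn he he1 he2 hx hy
      · exact Or.inl h6
      · linarith
    · obtain ⟨-, h6 | h6⟩ := F.near_np he he1 he2 (w := u) (by linarith) hyu
      · exact Or.inr h6
      · linarith
  obtain ⟨-, -, h | h⟩ := ha
  · obtain ⟨h5 | h5, -⟩ := F.pp.near u a b h hux huy hbx hby <;> rcases key with k | k <;> linarith
  · obtain ⟨h5 | h5, -⟩ := F.near_nn (w := e) h hux huy hxe hye <;> rcases key with k | k <;>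
      linarith

/-- If `a` precedes `b` in the fan of `u`, then `u` comes first in the opposite fan of `a`. -/
theorem Frame.first_opposite (F : Frame D x y) {u a b h : P} (ha : FEdge D x y u a)
    (hb : FEdge D x y u b) (hx : x b < x a) (hy : y a < y b) (hh : FEdge D x y h a)
    (hxh : x h < x u) (hyh : y u < y h) : False := by
  have hux := ha.1; have huy := ha.2.1; have hbx := hb.1; have hby := hb.2.1
  obtain ⟨hh1, hh2, hh⟩ := hh
  -- Both bounds are below `y b - y u`. Hence `a` is nearer to `u` than `b`, and `h` is nearer to
  -- `b` than `u`, against the edge between `u` and `b`.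
  have key : x a - x h ≤ y b - y h ∨ x a - x h ≤ y a - y u := by
    rcases hh with hh | hh
    · obtain ⟨h6 | h6, -⟩ := F.pp.near h a b hh hh1 hh2 (by linarith) (by linarith)
      · linarith
      · exact Or.inl h6
    · obtain ⟨h6 | h6, -⟩ := F.near_nn (w := u) hh hh1 hh2 hux huy
      · linarith
      · exact Or.inr h6
  obtain ⟨-, -, h' | h'⟩ := hb
  · obtain ⟨-, h5 | h5⟩ := F.pp.near u b a h' hbx hby hux huy <;> rcases key with k | k <;> linarith
  · obtain ⟨-, h5 | h5⟩ := F.near_nn (w := h) h' hbx hby (by linarith) (by linarith) <;>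
      rcases key with k | k <;> linarith

/-- The tail of a uni-directional canonical edge has no other edge in the cone of that edge. -/
theorem Frame.uni_single (F : Frame D x y) {u a b e : P} (ha : FEdge D x y u a)
    (hb : FEdge D x y u b) (hx : x b < x a) (hy : y a < y b)
    (hcons : ∀ c, FEdge D x y u c → ¬ (x b < x c ∧ x c < x a))
    (hba : D b a) (hab : ¬ D a b) (he : FEdge D x (-y) b e) : e = a := by
  by_contra hea
  have hlong : y b - y a < x a - x b := by
    by_contra hle
    refine hab (F.swap.arc hb.swap ha.swap hy hx ?_ (by linarith))
    intro c hc ⟨h1, h2⟩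
    exact hcons c hc.swap ⟨(F.staircase_iff hc.swap hb).2 h2, (F.staircase_iff ha hc.swap).2 h1⟩
  have hba' : FEdge D x (-y) b a := ⟨hx, by simpa using hy, Or.inl hba⟩
  obtain ⟨h1, h2⟩ | ⟨h1, h2⟩ := F.negy.staircase he hba' hea
  all_goals simp only [Pi.neg_apply, neg_lt_neg_iff] at h2
  · obtain ⟨he1, he2, he | he⟩ := he
    · exact hea (F.pn.uniq b e a he hba he1 he2 hba'.1 hba'.2.1)
    · simp only [Pi.neg_apply, neg_lt_neg_iff] at he2
      -- The arc of `a` in the quadrant of `b` goes to another point `c`. The empty rectangle pushes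
      -- `c` above `b`, and then `c` is nearer to `e` than `b`, so `e` cannot have an arc to `b`.
      obtain ⟨c, hac, hc1, hc2⟩ := F.np.exist a b (by simpa using hx) hy
      simp only [Pi.neg_apply, neg_lt_neg_iff] at hc1
      have hcb : c ≠ b := fun h => hab (h ▸ hac)
      obtain ⟨h3, h4⟩ := F.near_np hac hc1 hc2 hx hy
      have h3' : x a - x c ≤ x a - x b := by rcases h3 with h3 | h3 <;> linarith
      have h4' : y c - y a ≤ x a - x b := by rcases h4 with h4 | h4 <;> linarith
      have hbc : x b < x c := lt_of_le_of_ne (by linarith) fun h => hcb (F.injx _ _ h.symm)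
      have hyc : y b < y c := by
        rcases lt_trichotomy (y c) (y b) with h | h | h
        · exact (F.rect_empty ha hb hx hy hcons c hbc hc1 hc2 h).elim
        · exact (hcb (F.injy _ _ h)).elim
        · exact h
      obtain ⟨h5 | h5, -⟩ := F.near_np he he1 he2 (w := c) (by linarith) (by linarith) <;> linarith
  · exact F.first_side ha hb hx hy he h1 h2

/-! ### The four cones as frames, in both orientations -/

/-- The first coordinate of cone `i`; the second one is that of cone `i + 1`. -/
def coneCoord (i : Fin 4) (p : Pt) : ℝ :=
  match i with
  | 0 => p 0
  | 1 => p 1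
  | 2 => -p 0
  | 3 => -p 1

theorem inCone_iff (i : Fin 4) (u v : Pt) :
    InCone i u v ↔ coneCoord i u < coneCoord i v ∧ coneCoord (i + 1) u < coneCoord (i + 1) v := by
  fin_cases i <;> simp [InCone, coneCoord, and_comm]

theorem dInf_eq (i : Fin 4) (u v : Pt) :
    dInf u v = max |coneCoord i u - coneCoord i v| |coneCoord (i + 1) u - coneCoord (i + 1) v| := by
  fin_cases i <;> simp [dInf, coneCoord, max_comm, abs_sub_comm, neg_add_eq_sub]

theorem coneCoord_add_two (i : Fin 4) (p : Pt) : coneCoord (i + 2) p = -coneCoord i p := by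
  fin_cases i <;> simp [coneCoord]

theorem ccw_iff (i : Fin 4) (u a b : Pt) :
    Ccw u a b ↔ 0 < (coneCoord i a - coneCoord i u) * (coneCoord (i + 1) b - coneCoord (i + 1) u) -
      (coneCoord (i + 1) a - coneCoord (i + 1) u) * (coneCoord i b - coneCoord i u) := by
  unfold Ccw
  fin_cases i <;> simp [coneCoord] <;> constructor <;> intro h <;> linarith

theorem fin4_add_two_add_two (i : Fin 4) : i + 2 + 2 = i := by
  revert i; decide

theorem inCone_unique {i j : Fin 4} {u v : Pt} (h : InCone i u v) (h' : InCone j u v) : i = j := by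
  fin_cases i <;> fin_cases j <;> simp only [InCone] at h h' <;>
    first | rfl | (exfalso; obtain ⟨h1, h2⟩ := h; obtain ⟨h3, h4⟩ := h'; linarith)

theorem inCone_swap {i : Fin 4} {u v : Pt} : InCone (i + 2) v u ↔ InCone i u v := by
  rw [inCone_iff, inCone_iff, add_right_comm i 2 1, coneCoord_add_two,
    coneCoord_add_two, coneCoord_add_two, coneCoord_add_two, neg_lt_neg_iff, neg_lt_neg_iff]

theorem InCone.ne {i : Fin 4} {u v : P} (h : InCone i u v) : u ≠ v := by
  rintro rfl
  rw [inCone_iff] at h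
  exact lt_irrefl _ h.1

theorem exists_cone (hP : GeneralPosition P) {u v : P} (h : u ≠ v) : ∃ i, InCone i u v := by
  obtain ⟨h0, h1⟩ := hP.1 u u.2 v v.2 (fun e => h (Subtype.ext e))
  rcases lt_or_gt_of_ne h0 with a | a <;> rcases lt_or_gt_of_ne h1 with b | b
  · exact ⟨0, a, b⟩
  · exact ⟨3, a, b⟩
  · exact ⟨1, a, b⟩
  · exact ⟨2, a, b⟩

/-- The first coordinate of cone `i`, in the orientation `s` (the mirror image exchanges the two
coordinates). -/
def orCoord (s : Bool) (i : Fin 4) (p : P) : ℝ := coneCoord (if s then i else i + 1) p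

/-- The neighbouring cone of cone `i`, in the orientation `s`. -/
def turn (s : Bool) (i : Fin 4) : Fin 4 := if s then i + 1 else i + 3

/-- Along a fan one coordinate falls and the other rises, so canonical edges live in the frame
turned by a quarter; these identities move statements between the two frames. -/
theorem orCoord_turn (s : Bool) (i : Fin 4) :
    orCoord s (turn s i) = (orCoord (!s) i : P → ℝ) ∧
    orCoord (!s) (turn s i) = (-orCoord s i : P → ℝ) := by
  constructor <;> funext p <;> cases s <;> fin_cases i <;> simp [orCoord, turn, coneCoord]

theorem orCoord_add_two (s : Bool) (i : Fin 4) :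
    orCoord s (i + 2) = (-orCoord s i : P → ℝ) := by
  funext p; cases s <;> fin_cases i <;> simp [orCoord, coneCoord]

theorem turn_turn (s : Bool) (i : Fin 4) : turn s i + 2 = turn (!s) i := by
  cases s <;> revert i <;> decide

theorem inCone_iff_orCoord (s : Bool) {i : Fin 4} {u v : P} :
    InCone i u v ↔ orCoord s i u < orCoord s i v ∧ orCoord (!s) i u < orCoord (!s) i v := by
  cases s
  · rw [inCone_iff, and_comm]; rfl
  · exact inCone_iff _ _ _

theorem quad (hD : IsYaoDigraph D) (i : Fin 4) : Quad D (orCoord true i) (orCoord false i) where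
  near u v w h h1 h2 h3 h4 := by
    obtain ⟨j, hj, hmin⟩ := hD.nearest u v h
    have hi : InCone i u v := (inCone_iff_orCoord true).2 ⟨h1, h2⟩
    obtain rfl := inCone_unique hi hj
    have := hmin w ((inCone_iff_orCoord true).2 ⟨h3, h4⟩)
    rw [dInf_eq i, dInf_eq i] at this
    change max |orCoord true i u - orCoord true i v| |orCoord false i u - orCoord false i v| ≤
      max |orCoord true i u - orCoord true i w| |orCoord false i u - orCoord false i w| at this
    rw [abs_sub_comm, abs_of_pos (sub_pos.2 h1), abs_sub_comm, abs_of_pos (sub_pos.2 h2),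
      abs_sub_comm, abs_of_pos (sub_pos.2 h3), abs_sub_comm, abs_of_pos (sub_pos.2 h4)] at this
    rwa [max_le_iff, le_max_iff, le_max_iff] at this
  uniq u v w h h' h1 h2 h3 h4 := by
    have hv : InCone i u v := (inCone_iff_orCoord true).2 ⟨h1, h2⟩
    have hw : InCone i u w := (inCone_iff_orCoord true).2 ⟨h3, h4⟩
    exact (hD.choice u i ⟨v, hv⟩).unique ⟨hv, h⟩ ⟨hw, h'⟩
  exist u w h1 h2 := by
    obtain ⟨v, ⟨hv, h⟩, -⟩ := hD.choice u i ⟨w, (inCone_iff_orCoord true).2 ⟨h1, h2⟩⟩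
    exact ⟨v, h, ((inCone_iff_orCoord true).1 hv).1, ((inCone_iff_orCoord true).1 hv).2⟩

theorem orCoord_injective (hP : GeneralPosition P) (s : Bool) (i : Fin 4) (u v : P)
    (h : orCoord s i u = orCoord s i v) : u = v := by
  by_contra huv
  obtain ⟨h0, h1⟩ := hP.1 u u.2 v v.2 (fun e => huv (Subtype.ext e))
  cases s <;> fin_cases i <;> simp [orCoord, coneCoord] at h <;> first | exact h0 h | exact h1 h

theorem frame (hP : GeneralPosition P) (hD : IsYaoDigraph D) (s : Bool) (i : Fin 4) :
    Frame D (orCoord s i) (orCoord (!s) i) := by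
  have key : Frame D (orCoord true i) (orCoord false i) := by
    refine ⟨orCoord_injective hP _ _, orCoord_injective hP _ _, quad hD i, ?_, ?_, ?_⟩
    -- The quadrants with one reversed coordinate are the two neighbouring cones with their
    -- coordinates exchanged; reversing both gives the opposite cone.
    · have := (quad hD (turn true i)).swap
      rwa [(orCoord_turn true i).1, ← Bool.not_true, (orCoord_turn true i).2] at this
    · have := (quad hD (turn false i)).swap
      rwa [(orCoord_turn false i).1, ← Bool.not_false, (orCoord_turn false i).2] at this
    · have := quad hD (i + 2)
      rwa [orCoord_add_two, orCoord_add_two] at this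
  cases s
  · exact key.swap
  · exact key

/-! ### Fans -/

theorem yaoGraph_adj_of_arc {i : Fin 4} {u v : P} (h : InCone i u v) (hD : D u v ∨ D v u) :
    (yaoGraph D).Adj u v := by
  rw [yaoGraph, SimpleGraph.fromRel_adj]
  exact ⟨h.ne, hD⟩

theorem fanMem_iff (s : Bool) {i : Fin 4} {u v : P} :
    FanMem D i u v ↔ FEdge D (orCoord s i) (orCoord (!s) i) u v := by
  rw [FanMem, inCone_iff_orCoord s, yaoGraph, SimpleGraph.fromRel_adj]
  constructor
  · rintro ⟨⟨-, h⟩, h1, h2⟩; exact ⟨h1, h2, h⟩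
  · rintro ⟨h1, h2, h⟩
    exact ⟨⟨fun e => by subst e; exact lt_irrefl _ h1, h⟩, h1, h2⟩

theorem FanMem.symm {i : Fin 4} {u v : P} (h : FanMem D i u v) : FanMem D (i + 2) v u :=
  ⟨h.1.symm, inCone_swap.2 h.2⟩

theorem FanMem.symm' {i : Fin 4} {u v : P} (h : FanMem D (i + 2) u v) : FanMem D i v u := by
  simpa only [fin4_add_two_add_two] using h.symm

theorem FanMem.arc {i : Fin 4} {u v : P} (h : FanMem D i u v) : D u v ∨ D v u :=
  ((fanMem_iff true).1 h).2.2

theorem out_unique (hD : IsYaoDigraph D) {i : Fin 4} {u v w : P} (hv : InCone i u v)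
    (hw : InCone i u w) (h : D u v) (h' : D u w) : v = w :=
  (hD.choice u i ⟨v, hv⟩).unique ⟨hv, h⟩ ⟨hw, h'⟩

theorem ccw_iff_orCoord (hP : GeneralPosition P) (hD : IsYaoDigraph D) {i : Fin 4} {u a b : P}
    (ha : FanMem D i u a) (hb : FanMem D i u b) :
    Ccw u a b ↔ orCoord true i b < orCoord true i a := by
  have F := frame hP hD true i
  have ha' := (fanMem_iff true).1 ha
  have hb' := (fanMem_iff true).1 hb
  rw [ccw_iff i]
  change 0 < (orCoord true i a - orCoord true i u) * (orCoord false i b - orCoord false i u) -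
    (orCoord false i a - orCoord false i u) * (orCoord true i b - orCoord true i u) ↔ _
  obtain ⟨h1, h2, -⟩ := ha'
  obtain ⟨h3, h4, -⟩ := hb'
  simp only [Bool.not_true] at h2 h4
  constructor
  · intro h
    by_contra hle
    by_cases hab : a = b
    · subst hab; linarith
    · obtain h' | h' := F.staircase ((fanMem_iff true).1 ha) ((fanMem_iff true).1 hb) hab
      · exact hle h'.1
      · simp only [Bool.not_true] at h'
        nlinarith
  · intro h
    have := (F.staircase_iff ((fanMem_iff true).1 ha) ((fanMem_iff true).1 hb)).1 h
    simp only [Bool.not_true] at this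
    nlinarith

theorem orCoord_not_lt (hP : GeneralPosition P) (hD : IsYaoDigraph D) (s : Bool) {i : Fin 4}
    {u a b : P} (ha : FanMem D i u a) (hb : FanMem D i u b) :
    orCoord (!s) i a < orCoord (!s) i b ↔ orCoord s i b < orCoord s i a :=
  ((frame hP hD s i).staircase_iff ((fanMem_iff s).1 ha) ((fanMem_iff s).1 hb)).symm

/-- `b` is the successor of `a` in the fan of `u` in its cone `i`, in the orientation `s`
(`true` for counter-clockwise). -/
def OrNext (D : P → P → Prop) (s : Bool) (i : Fin 4) (u a b : P) : Prop :=
  FanMem D i u a ∧ FanMem D i u b ∧ orCoord s i b < orCoord s i a ∧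
    ∀ c : P, FanMem D i u c → ¬ (orCoord s i b < orCoord s i c ∧ orCoord s i c < orCoord s i a)

/-- By the staircase property the two coordinates order a fan oppositely. This lets every later
result be proved in one orientation only. -/
theorem orNext_not (hP : GeneralPosition P) (hD : IsYaoDigraph D) (s : Bool) {i : Fin 4}
    {u a b : P} : OrNext D (!s) i u a b ↔ OrNext D s i u b a := by
  constructor
  · rintro ⟨ha, hb, h, hc⟩
    refine ⟨hb, ha, (orCoord_not_lt hP hD s hb ha).1 h, fun c hcm ⟨h1, h2⟩ => hc c hcm ⟨?_, ?_⟩⟩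
    · exact (orCoord_not_lt hP hD s hb hcm).2 h2
    · exact (orCoord_not_lt hP hD s hcm ha).2 h1
  · rintro ⟨hb, ha, h, hc⟩
    refine ⟨ha, hb, (orCoord_not_lt hP hD s hb ha).2 h, fun c hcm ⟨h1, h2⟩ => hc c hcm ⟨?_, ?_⟩⟩
    · exact (orCoord_not_lt hP hD s hcm ha).1 h2
    · exact (orCoord_not_lt hP hD s hb hcm).1 h1

theorem fanNext_iff (hP : GeneralPosition P) (hD : IsYaoDigraph D) {i : Fin 4} {u a b : P} :
    FanNext D i u a b ↔ OrNext D true i u a b := by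
  constructor
  · rintro ⟨ha, hb, h, hc⟩
    exact ⟨ha, hb, (ccw_iff_orCoord hP hD ha hb).1 h, fun c hcm ⟨h1, h2⟩ => hc c hcm
      ⟨(ccw_iff_orCoord hP hD ha hcm).2 h2, (ccw_iff_orCoord hP hD hcm hb).2 h1⟩⟩
  · rintro ⟨ha, hb, h, hc⟩
    exact ⟨ha, hb, (ccw_iff_orCoord hP hD ha hb).2 h, fun c hcm ⟨h1, h2⟩ => hc c hcm
      ⟨(ccw_iff_orCoord hP hD hcm hb).1 h2, (ccw_iff_orCoord hP hD ha hcm).1 h1⟩⟩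

theorem fanNext_iff' (hP : GeneralPosition P) (hD : IsYaoDigraph D) {i : Fin 4} {u a b : P} :
    FanNext D i u a b ↔ OrNext D false i u b a := by
  rw [fanNext_iff hP hD, ← orNext_not hP hD true]; rfl

theorem canonical_iff (hP : GeneralPosition P) (hD : IsYaoDigraph D) {a b : P} :
    Canonical D a b ↔ ∃ s i u, OrNext D s i u a b := by
  constructor
  · rintro ⟨i, u, h | h⟩
    · exact ⟨true, i, u, (fanNext_iff hP hD).1 h⟩
    · exact ⟨false, i, u, (fanNext_iff' hP hD).1 h⟩
  · rintro ⟨_ | _, i, u, h⟩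
    · exact ⟨i, u, Or.inr ((fanNext_iff' hP hD).2 h)⟩
    · exact ⟨i, u, Or.inl ((fanNext_iff hP hD).2 h)⟩

theorem Canonical.symm {a b : P} (h : Canonical D a b) : Canonical D b a := by
  obtain ⟨i, u, h | h⟩ := h
  · exact ⟨i, u, Or.inr h⟩
  · exact ⟨i, u, Or.inl h⟩

theorem OrNext.consecutive {s : Bool} {i : Fin 4} {u a b : P} (h : OrNext D s i u a b) (c : P)
    (hc : FEdge D (orCoord s i) (orCoord (!s) i) u c) :
    ¬ (orCoord s i b < orCoord s i c ∧ orCoord s i c < orCoord s i a) :=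
  h.2.2.2 c ((fanMem_iff s).2 hc)

theorem orNext_unique_right (hP : GeneralPosition P) {s : Bool} {i : Fin 4} {u a b b' : P}
    (h : OrNext D s i u a b) (h' : OrNext D s i u a b') : b = b' := by
  refine orCoord_injective hP s i _ _ (le_antisymm ?_ ?_)
  · by_contra hlt
    exact h'.2.2.2 b h.2.1 ⟨not_le.1 hlt, h.2.2.1⟩
  · by_contra hlt
    exact h.2.2.2 b' h'.2.1 ⟨not_le.1 hlt, h'.2.2.1⟩

theorem exists_orNext {s : Bool} {i : Fin 4} {u a c : P} (ha : FanMem D i u a)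
    (hc : FanMem D i u c) (h : orCoord s i c < orCoord s i a) :
    ∃ b, OrNext D s i u a b ∧ orCoord s i c ≤ orCoord s i b := by
  obtain ⟨b, ⟨hb, hba⟩, hmax⟩ := Set.exists_max_image
    {b : P | FanMem D i u b ∧ orCoord s i b < orCoord s i a} (orCoord s i) (Set.toFinite _)
    ⟨c, hc, h⟩
  exact ⟨b, ⟨ha, hb, hba, fun d hd ⟨h1, h2⟩ => absurd (hmax d ⟨hd, h2⟩) (not_le.2 h1)⟩,
    hmax c ⟨hc, h⟩⟩

theorem exists_orPrev {s : Bool} {i : Fin 4} {u a c : P} (ha : FanMem D i u a)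
    (hc : FanMem D i u c) (h : orCoord s i a < orCoord s i c) :
    ∃ b, OrNext D s i u b a ∧ orCoord s i b ≤ orCoord s i c := by
  obtain ⟨b, ⟨hb, hba⟩, hmin⟩ := Set.exists_min_image
    {b : P | FanMem D i u b ∧ orCoord s i a < orCoord s i b} (orCoord s i) (Set.toFinite _)
    ⟨c, hc, h⟩
  exact ⟨b, ⟨hb, ha, hba, fun d hd ⟨h1, h2⟩ => absurd (hmin d ⟨hd, h1⟩) (not_le.2 h2)⟩,
    hmin c ⟨hc, h⟩⟩

/-! ### Canonical edges -/

theorem OrNext.arc (hP : GeneralPosition P) (hD : IsYaoDigraph D)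
    {s : Bool} {i : Fin 4} {u a b : P} (h : OrNext D s i u a b)
    (hle : orCoord (!s) i b - orCoord (!s) i a ≤ orCoord s i a - orCoord s i b) : D b a :=
  (frame hP hD s i).arc ((fanMem_iff s).1 h.1) ((fanMem_iff s).1 h.2.1) h.2.2.1
    ((orCoord_not_lt hP hD s h.1 h.2.1).2 h.2.2.1) h.consecutive hle

theorem OrNext.inCone (hP : GeneralPosition P) (hD : IsYaoDigraph D)
    {s : Bool} {i : Fin 4} {u a b : P} (h : OrNext D s i u a b) :
    InCone (turn s i) a b := by
  rw [inCone_iff_orCoord s, (orCoord_turn s i).1, (orCoord_turn s i).2]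
  exact ⟨(orCoord_not_lt hP hD s h.1 h.2.1).2 h.2.2.1, by simpa using h.2.2.1⟩

theorem OrNext.arc_or (hP : GeneralPosition P) (hD : IsYaoDigraph D)
    {s : Bool} {i : Fin 4} {u a b : P} (h : OrNext D s i u a b) :
    D a b ∨ D b a := by
  rcases le_total (orCoord (!s) i b - orCoord (!s) i a) (orCoord s i a - orCoord s i b) with hle | hle
  · exact Or.inr (h.arc hP hD hle)
  · refine Or.inl (OrNext.arc hP hD ((orNext_not hP hD s).2 h) ?_)
    rw [Bool.not_not]; linarith

theorem OrNext.fanMem (hP : GeneralPosition P) (hD : IsYaoDigraph D)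
    {s : Bool} {i : Fin 4} {u a b : P} (h : OrNext D s i u a b) :
    FanMem D (turn s i) a b :=
  ⟨yaoGraph_adj_of_arc (h.inCone hP hD) (h.arc_or hP hD), h.inCone hP hD⟩

theorem uniArc_extent (hP : GeneralPosition P) (hD : IsYaoDigraph D)
    {s : Bool} {i : Fin 4} {u a b : P} (h : OrNext D s i u a b)
    (hab : UniArc D a b) :
    orCoord s i a - orCoord s i b < orCoord (!s) i b - orCoord (!s) i a := by
  by_contra hle
  exact hab.2 (h.arc hP hD (not_lt.1 hle))

/-- In the fan of `b` in the cone containing `a`, the edge `(b, a)` is extreme. -/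
theorem OrNext.first_side (hP : GeneralPosition P) (hD : IsYaoDigraph D)
    {s : Bool} {i : Fin 4} {u a b e : P} (h : OrNext D s i u a b)
    (he : FanMem D (turn (!s) i) b e) :
    orCoord s (turn (!s) i) e ≤ orCoord s (turn (!s) i) a := by
  have h1 := (orCoord_turn (P := P) (!s) i).1
  have h2 := (orCoord_turn (P := P) (!s) i).2
  rw [Bool.not_not] at h1 h2
  have hba := ((orNext_not hP hD s).2 h).fanMem hP hD
  by_contra hlt
  rw [not_le] at hlt
  have hlt2 := (orCoord_not_lt hP hD s he hba).2 hlt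
  have he' := (fanMem_iff (!s)).1 he
  rw [Bool.not_not, h1, h2] at he'
  rw [h2] at hlt
  rw [h1] at hlt2
  exact (frame hP hD s i).first_side ((fanMem_iff s).1 h.1) ((fanMem_iff s).1 h.2.1) h.2.2.1
    ((orCoord_not_lt hP hD s h.1 h.2.1).2 h.2.2.1) he' hlt2 (by simpa using hlt)

/-- If `a` precedes `b` in the fan of `u`, then `u` comes first in the opposite fan of `a`. -/
theorem first_opposite (hP : GeneralPosition P) (hD : IsYaoDigraph D) {s : Bool} {i : Fin 4}
    {u a b e : P} (ha : FanMem D i u a) (hb : FanMem D i u b) (h : orCoord s i b < orCoord s i a)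
    (he : FanMem D (i + 2) a e) : orCoord s (i + 2) e ≤ orCoord s (i + 2) u := by
  by_contra hlt
  rw [not_le] at hlt
  have hlt2 := (orCoord_not_lt hP hD s he ha.symm).2 hlt
  rw [orCoord_add_two] at hlt hlt2
  exact (frame hP hD s i).first_opposite ((fanMem_iff s).1 ha) ((fanMem_iff s).1 hb) h
    ((orCoord_not_lt hP hD s ha hb).2 h) ((fanMem_iff s).1 he.symm') (by simpa using hlt)
    (by simpa using hlt2)

theorem last_opposite (hP : GeneralPosition P) (hD : IsYaoDigraph D) {s : Bool} {i : Fin 4}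
    {u a b e : P} (ha : FanMem D i u a) (hb : FanMem D i u b) (h : orCoord s i b < orCoord s i a)
    (he : FanMem D (i + 2) b e) : orCoord s (i + 2) u ≤ orCoord s (i + 2) e := by
  have := first_opposite hP hD (s := !s) hb ha ((orCoord_not_lt hP hD s ha hb).2 h) he
  by_contra hlt
  exact not_lt.2 this ((orCoord_not_lt hP hD s hb.symm he).2 (not_le.1 hlt))

/-- Only the extreme edges of a fan can be dual. -/
theorem single_of_between (hP : GeneralPosition P) (hD : IsYaoDigraph D) {s : Bool} {i : Fin 4}
    {u a b c e : P} (ha : FanMem D i u a) (hb : FanMem D i u b) (hc : FanMem D i u c)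
    (hab : orCoord s i b < orCoord s i a) (hbc : orCoord s i c < orCoord s i b)
    (he : FanMem D (i + 2) b e) : e = u :=
  orCoord_injective hP s (i + 2) _ _
    (le_antisymm (first_opposite hP hD hb hc hbc he) (last_opposite hP hD ha hb hab he))

theorem OrNext.last_side (hP : GeneralPosition P) (hD : IsYaoDigraph D) {s : Bool} {i : Fin 4}
    {u a b e : P} (h : OrNext D s i u a b) (he : FanMem D (turn s i) a e) :
    orCoord s (turn s i) b ≤ orCoord s (turn s i) e := by
  have := OrNext.first_side hP hD (s := !s) (e := e) ((orNext_not hP hD s).2 h) (by simpa using he)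
  rw [Bool.not_not] at this
  by_contra hlt
  exact not_lt.2 this ((orCoord_not_lt hP hD s (h.fanMem hP hD) he).2 (not_le.1 hlt))

/-- The tail of a uni-directional canonical edge has no other edge in the cone of that edge. -/
theorem OrNext.uni_single (hP : GeneralPosition P) (hD : IsYaoDigraph D) {s : Bool} {i : Fin 4}
    {u a b e : P} (h : OrNext D s i u a b) (hba : UniArc D b a)
    (he : FanMem D (turn (!s) i) b e) : e = a := by
  have h1 := (orCoord_turn (P := P) (!s) i).1
  have h2 := (orCoord_turn (P := P) (!s) i).2
  rw [Bool.not_not] at h1 h2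
  have he' := (fanMem_iff (!s)).1 he
  rw [Bool.not_not, h1, h2] at he'
  exact (frame hP hD s i).uni_single ((fanMem_iff s).1 h.1) ((fanMem_iff s).1 h.2.1) h.2.2.1
    ((orCoord_not_lt hP hD s h.1 h.2.1).2 h.2.2.1) h.consecutive hba.1 hba.2 he'

/-- `(u, a)` is the last edge of the fan of `u` in its cone `i`, in the orientation `s`. -/
def OrLast (D : P → P → Prop) (s : Bool) (i : Fin 4) (u a : P) : Prop :=
  FanMem D i u a ∧ ∀ c, FanMem D i u c → orCoord s i a ≤ orCoord s i c

theorem fanLast_iff (hP : GeneralPosition P) (hD : IsYaoDigraph D) {i : Fin 4} {u a : P} :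
    FanLast D i u a ↔ OrLast D true i u a := by
  refine and_congr_right fun ha => forall₂_congr fun c hc => ?_
  rw [ccw_iff_orCoord hP hD ha hc, not_lt]

theorem fanFirst_iff (hP : GeneralPosition P) (hD : IsYaoDigraph D) {i : Fin 4} {u a : P} :
    FanFirst D i u a ↔ OrLast D false i u a := by
  refine and_congr_right fun ha => forall₂_congr fun c hc => ?_
  rw [ccw_iff_orCoord hP hD hc ha, ← not_lt, ← orCoord_not_lt hP hD true hc ha]; rfl

theorem OrNext.orLast (hP : GeneralPosition P) (hD : IsYaoDigraph D) {s : Bool} {j : Fin 4}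
    {x u a : P} (h : OrNext D s j x u a) : OrLast D s (turn s j) u a :=
  ⟨h.fanMem hP hD, fun _ hc => h.last_side hP hD hc⟩

theorem FanMulti.exists_ne {i : Fin 4} {u : P} (h : FanMulti D i u) (a : P) :
    ∃ b, b ≠ a ∧ FanMem D i u b := by
  obtain ⟨b, c, hbc, hb, hc⟩ := h
  by_cases hba : b = a
  · exact ⟨c, fun e => hbc (hba.trans e.symm), hc⟩
  · exact ⟨b, hba, hb⟩

/-- A canonical edge that is not alone in the cone of one of its ends is alone in the cone of the
other one. -/
theorem OrNext.opposite_single (hP : GeneralPosition P) (hD : IsYaoDigraph D) {s : Bool}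
    {j : Fin 4} {x u a e : P} (h : OrNext D s j x u a) (hm : FanMulti D (turn s j) u)
    (he : FanMem D (turn s j + 2) a e) : e = u := by
  obtain ⟨b, hba, hb⟩ := hm.exists_ne a
  have ha := h.fanMem hP hD
  have hlt : orCoord s (turn s j) a < orCoord s (turn s j) b :=
    lt_of_le_of_ne (h.last_side hP hD hb) fun e => hba (orCoord_injective hP _ _ _ _ e).symm
  -- In the fan of `a`, the node `u` is extreme on one side because the fan of `u` has a further
  -- member `b`, and on the other side because the edge is canonical.
  refine orCoord_injective hP s (turn s j + 2) _ _ (le_antisymm ?_ (last_opposite hP hD hb ha hlt he))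
  rw [turn_turn] at he ⊢
  exact h.first_side hP hD he

/-! ### Anchors -/

theorem canPath_iff (hP : GeneralPosition P) (hD : IsYaoDigraph D) {i : Fin 4} {u a b : P}
    {p : List P} : CanPath D i u a b p ↔ FanMem D i u a ∧ FanMem D i u b ∧ p.head? = some a ∧
      p.getLast? = some b ∧ ∃ s, p.IsChain (OrNext D s i u) := by
  have h1 : FanNext D i u = OrNext D true i u := by
    funext a b; exact propext (fanNext_iff hP hD)
  have h2 : (fun a b => FanNext D i u b a) = OrNext D false i u := by
    funext a b; exact propext (fanNext_iff' hP hD)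
  rw [CanPath, h2]
  change _ ∧ _ ∧ _ ∧ _ ∧ (p.IsChain (FanNext D i u) ∨ _) ↔ _
  rw [h1, Bool.exists_bool, or_comm]

theorem orCoord_le_of_chain {s : Bool} {i : Fin 4} {u : P} (p : List P) :
    ∀ {a b : P}, p.head? = some a → p.getLast? = some b → p.IsChain (OrNext D s i u) →
      orCoord s i b ≤ orCoord s i a := by
  induction p with
  | nil => intro a b h; simp at h
  | cons c p ih =>
    intro a b ha hb hc
    obtain rfl : c = a := by simpa using ha
    cases p with
    | nil => obtain rfl : c = b := by simpa using hb
             exact le_rfl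
    | cons d p =>
      rw [List.isChain_cons_cons] at hc
      exact (ih rfl (by simpa using hb) hc.2).trans hc.1.2.2.1.le

/-- A chain of consecutive members skips nothing, so every consecutive pair between its ends is one
of its edges. -/
theorem uniArc_of_chain (hP : GeneralPosition P) {s : Bool} {i : Fin 4} {u : P} (p : List P) :
    ∀ {v t : P}, p.head? = some v → p.getLast? = some t → p.IsChain (OrNext D s i u) →
      p.IsChain (UniArc D) → ∀ a b, OrNext D s i u a b → orCoord s i a ≤ orCoord s i v →
      orCoord s i t ≤ orCoord s i b → UniArc D a b := by
  induction p with
  | nil => intro v t h; simp at h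
  | cons c p ih =>
    intro v t hv ht hc hu a b hab hav htb
    obtain rfl : c = v := by simpa using hv
    cases p with
    | nil =>
      obtain rfl : c = t := by simpa using ht
      exact absurd hab.2.2.1 (not_lt.2 (hav.trans htb))
    | cons d p =>
      rw [List.isChain_cons_cons] at hc hu
      rcases hav.eq_or_lt with h | h
      · obtain rfl := orCoord_injective hP _ _ _ _ h
        rw [orNext_unique_right hP hab hc.1]
        exact hu.1
      · refine ih rfl (by simpa using ht) hc.2 hu.2 a b hab ?_ htb
        by_contra hlt
        exact hc.1.2.2.2 a hab.1 ⟨not_le.1 hlt, h⟩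

/-- `v` is the start of the maximal uni-directional canonical path that ends at `t` and runs in the
orientation `s`. -/
def PathStart (D : P → P → Prop) (s : Bool) (i : Fin 4) (u v t : P) : Prop :=
  FanMem D i u v ∧ orCoord s i t < orCoord s i v ∧
  (∀ a b, OrNext D s i u a b → orCoord s i a ≤ orCoord s i v → orCoord s i t ≤ orCoord s i b →
    UniArc D a b) ∧
  ∀ a, OrNext D s i u a v → ¬ UniArc D a v

/-- A uni-directional canonical edge in the orientation `s` ends at `t`. -/
def UniInto (D : P → P → Prop) (s : Bool) (i : Fin 4) (u t : P) : Prop :=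
  ∃ a, OrNext D s i u a t ∧ UniArc D a t

/-- Replaces maximality among lists by a condition on the order of the fan, from which uniqueness of
the start is immediate. -/
theorem MaxUniCanPath.pathStart (hP : GeneralPosition P) (hD : IsYaoDigraph D) {s : Bool}
    {i : Fin 4} {u v t : P} {p : List P} (h : MaxUniCanPath D i u v t p)
    (hlt : orCoord s i t < orCoord s i v) : PathStart D s i u v t := by
  obtain ⟨⟨hcan, huni⟩, hmax⟩ := h
  obtain ⟨hv, ht, hhead, hlast, s', hchain⟩ := (canPath_iff hP hD).1 hcan
  have hs : s' = s := by
    by_contra hne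
    obtain rfl : s' = !s := by cases s <;> cases s' <;> simp_all
    have := orCoord_le_of_chain p hhead hlast hchain
    exact not_lt.2 this ((orCoord_not_lt hP hD s hv ht).2 hlt)
  subst hs
  refine ⟨hv, hlt, uniArc_of_chain hP p hhead hlast hchain huni, fun a ha hua => ?_⟩
  have hp : ∀ c ∈ p.head?, OrNext D s' i u a c ∧ UniArc D a c := by
    intro c hc
    obtain rfl : v = c := by rw [hhead] at hc; simpa using hc
    exact ⟨ha, hua⟩
  have : a :: p = p := by
    refine hmax a (a :: p) ⟨(canPath_iff hP hD).2 ⟨ha.1, ht, rfl, ?_, s', ?_⟩, ?_⟩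
      (List.suffix_cons a p)
    · rw [List.getLast?_cons, hlast]; rfl
    · exact List.isChain_cons.2 ⟨fun c hc => (hp c hc).1, hchain⟩
    · exact List.isChain_cons.2 ⟨fun c hc => (hp c hc).2, huni⟩
  simpa using congrArg List.length this

theorem PathStart.unique (hP : GeneralPosition P) {s : Bool} {i : Fin 4}
    {u v v' t : P} (h : PathStart D s i u v t) (h' : PathStart D s i u v' t) : v = v' := by
  have key : ∀ {v v' : P}, PathStart D s i u v t → PathStart D s i u v' t →
      ¬ orCoord s i v < orCoord s i v' := by
    intro v v' h h' hlt
    obtain ⟨a, ha, hle⟩ := exists_orPrev h.1 h'.1 hlt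
    exact h.2.2.2 a ha (h'.2.2.1 a v ha hle h.2.1.le)
  exact orCoord_injective hP _ _ _ _ (le_antisymm (not_lt.1 (key h' h)) (not_lt.1 (key h h')))

/-- The path is prolonged backwards as long as possible; the fan being finite, this ends. The strict
inequality keeps at least one edge on the path, which fixes its orientation. -/
theorem exists_maxUniCanPath (hP : GeneralPosition P) (hD : IsYaoDigraph D) {s : Bool}
    {i : Fin 4} {u t : P} (ht : FanMem D i u t) :
    ∀ (v : P) (p : List P), FanMem D i u v → orCoord s i t < orCoord s i v → p.head? = some v →
      p.getLast? = some t → p.IsChain (OrNext D s i u) → p.IsChain (UniArc D) →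
      ∃ v' p', orCoord s i t < orCoord s i v' ∧ MaxUniCanPath D i u v' t p' := by
  have wf : WellFounded (fun a b : P => orCoord s i b < orCoord s i a) :=
    @Finite.wellFounded_of_trans_of_irrefl _ _ _ ⟨fun _ _ _ h1 h2 => h2.trans h1⟩
      ⟨fun _ => lt_irrefl _⟩
  intro v
  induction v using wf.induction with
  | _ v ih =>
    intro p hv hlt hhead hlast hchain huni
    by_cases hex : ∃ a, OrNext D s i u a v ∧ UniArc D a v
    · obtain ⟨a, ha, hua⟩ := hex
      have hp : ∀ c ∈ p.head?, OrNext D s i u a c ∧ UniArc D a c := by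
        intro c hc
        obtain rfl : v = c := by rw [hhead] at hc; simpa using hc
        exact ⟨ha, hua⟩
      exact ih a ha.2.2.1 (a :: p) ha.1 (hlt.trans ha.2.2.1) rfl
        (by rw [List.getLast?_cons, hlast]; rfl)
        (List.isChain_cons.2 ⟨fun c hc => (hp c hc).1, hchain⟩)
        (List.isChain_cons.2 ⟨fun c hc => (hp c hc).2, huni⟩)
    · refine ⟨v, p, hlt, ⟨(canPath_iff hP hD).2 ⟨hv, ht, hhead, hlast, s, hchain⟩, huni⟩, ?_⟩
      rintro v' p' ⟨hcan, huni'⟩ ⟨l, rfl⟩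
      obtain ⟨-, -, -, -, s', hchain'⟩ := (canPath_iff hP hD).1 hcan
      rcases List.eq_nil_or_concat l with rfl | ⟨l, a, rfl⟩
      · rfl
      · exfalso
        obtain ⟨q, rfl⟩ : ∃ q, p = v :: q := by
          cases p with
          | nil => simp at hhead
          | cons c q => exact ⟨q, by simpa using hhead⟩
        cases q with
        | nil =>
          obtain rfl : v = t := by simpa using hlast
          exact lt_irrefl _ hlt
        | cons w q =>
          have e : l.concat a ++ v :: w :: q = l ++ a :: v :: w :: q := by simp
          rw [e] at hchain' huni'
          have h1 := (List.isChain_append.1 hchain').2.1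
          have h2 := (List.isChain_append.1 huni').2.1
          rw [List.isChain_cons_cons, List.isChain_cons_cons] at h1
          rw [List.isChain_cons_cons] at h2 hchain
          -- The edge from `v` to `w` belongs to both paths, so the longer one cannot run the other
          -- way round the fan.
          have hs : s' = s := by
            by_contra hne
            obtain rfl : s' = !s := by cases s <;> cases s' <;> simp_all
            have := (orNext_not hP hD s).1 h1.2.1
            exact lt_asymm this.2.2.1 hchain.1.2.2.1
          subst hs
          exact hex ⟨a, h1.1, h2.1⟩

theorem uniFromPrev_iff (hP : GeneralPosition P) (hD : IsYaoDigraph D) {i : Fin 4} {u t : P} :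
    UniFromPrev D i u t ↔ UniInto D true i u t :=
  exists_congr fun _ => and_congr_left fun _ => fanNext_iff hP hD

theorem uniFromNext_iff (hP : GeneralPosition P) (hD : IsYaoDigraph D) {i : Fin 4} {u t : P} :
    UniFromNext D i u t ↔ UniInto D false i u t :=
  exists_congr fun _ => and_congr_left fun _ => fanNext_iff' hP hD

theorem FanMulti.exists_arc (hD : IsYaoDigraph D) {i : Fin 4} {u : P} (h : FanMulti D i u) :
    ∃ t : P, InCone i u t ∧ D u t := by
  obtain ⟨a, -, -, ha, -⟩ := h
  obtain ⟨t, ht, -⟩ := hD.choice u i ⟨a, ha.2⟩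
  exact ⟨t, ht⟩

theorem fanMem_of_arc {i : Fin 4} {u t : P} (h : InCone i u t) (h' : D u t) : FanMem D i u t :=
  ⟨yaoGraph_adj_of_arc h (Or.inl h'), h⟩

theorem exists_anchor (hP : GeneralPosition P) (hD : IsYaoDigraph D) {i : Fin 4} {u : P}
    (h : FanMulti D i u) : ∃ v, IsAnchor D i u v := by
  obtain ⟨t, ht, hut⟩ := h.exists_arc hD
  have htm := fanMem_of_arc ht hut
  have key : ∀ s, UniInto D s i u t →
      ∃ v p, orCoord s i t < orCoord s i v ∧ MaxUniCanPath D i u v t p := by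
    rintro s ⟨a, ha, hua⟩
    exact exists_maxUniCanPath hP hD htm a [a, t] ha.1 ha.2.2.1 rfl rfl
      (List.isChain_pair.2 ha) (List.isChain_pair.2 hua)
  by_cases h1 : UniInto D true i u t
  · obtain ⟨v, p, hlt, hmax⟩ := key true h1
    exact ⟨v, Or.inr ⟨h, t, ht, hut, Or.inl ⟨(uniFromPrev_iff hP hD).2 h1,
      (ccw_iff_orCoord hP hD hmax.1.1.1 htm).2 hlt, p, hmax⟩⟩⟩
  · by_cases h2 : UniInto D false i u t
    · obtain ⟨v, p, hlt, hmax⟩ := key false h2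
      exact ⟨v, Or.inr ⟨h, t, ht, hut, Or.inr (Or.inl ⟨fun h => h1 ((uniFromPrev_iff hP hD).1 h),
        (uniFromNext_iff hP hD).2 h2, (ccw_iff_orCoord hP hD htm hmax.1.1.1).2
          ((orCoord_not_lt hP hD true htm hmax.1.1.1).1 hlt), p, hmax⟩)⟩⟩
    · exact ⟨t, Or.inr ⟨h, t, ht, hut, Or.inr (Or.inr ⟨fun h => h1 ((uniFromPrev_iff hP hD).1 h),
        fun h => h2 ((uniFromNext_iff hP hD).1 h), rfl⟩)⟩⟩

theorem IsAnchor.cases (hP : GeneralPosition P) (hD : IsYaoDigraph D) {i : Fin 4} {u v : P}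
    (h : IsAnchor D i u v) : MutuallySingle D i u v ∨ (FanMulti D i u ∧ ∃ t, FanMem D i u t ∧
      D u t ∧ ((UniInto D true i u t ∧ PathStart D true i u v t) ∨
        (¬ UniInto D true i u t ∧ UniInto D false i u t ∧ PathStart D false i u v t) ∨
        (¬ UniInto D true i u t ∧ ¬ UniInto D false i u t ∧ v = t))) := by
  obtain h | ⟨hm, t, ht, hut, h⟩ := h
  · exact Or.inl h
  refine Or.inr ⟨hm, t, fanMem_of_arc ht hut, hut, ?_⟩
  have htm := fanMem_of_arc ht hut
  rw [uniFromPrev_iff hP hD, uniFromNext_iff hP hD] at h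
  obtain ⟨h1, h2, p, hp⟩ | ⟨h1, h2, h3, p, hp⟩ | h := h
  · exact Or.inl ⟨h1, hp.pathStart hP hD ((ccw_iff_orCoord hP hD hp.1.1.1 htm).1 h2)⟩
  · exact Or.inr (Or.inl ⟨h1, h2, hp.pathStart hP hD
      ((orCoord_not_lt hP hD true htm hp.1.1.1).2 ((ccw_iff_orCoord hP hD htm hp.1.1.1).1 h3))⟩)
  · exact Or.inr (Or.inr h)

theorem IsAnchor.fanMem (hP : GeneralPosition P) (hD : IsYaoDigraph D) {i : Fin 4} {u v : P}
    (h : IsAnchor D i u v) : FanMem D i u v := by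
  obtain h | ⟨-, t, ht, -, h | h | h⟩ := h.cases hP hD
  · exact h.1
  · exact h.2.1
  · exact h.2.2.1
  · exact h.2.2 ▸ ht

theorem IsAnchor.unique (hP : GeneralPosition P) (hD : IsYaoDigraph D) {i : Fin 4} {u v w : P}
    (h : IsAnchor D i u v) (h' : IsAnchor D i u w) : v = w := by
  have hv := h.fanMem hP hD
  have hw := h'.fanMem hP hD
  obtain h | ⟨-, t, ht, hut, h⟩ := h.cases hP hD
  · by_contra hne
    exact h.2.1 ⟨v, w, hne, hv, hw⟩
  obtain h' | ⟨-, t', ht', hut', h'⟩ := h'.cases hP hD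
  · by_contra hne
    exact h'.2.1 ⟨v, w, hne, hv, hw⟩
  obtain rfl := out_unique hD ht.2 ht'.2 hut hut'
  obtain h | h | h := h <;> obtain h' | h' | h' := h'
  · exact h.2.unique hP h'.2
  · exact (h'.1 h.1).elim
  · exact (h'.1 h.1).elim
  · exact (h.1 h'.1).elim
  · exact h.2.2.unique hP h'.2.2
  · exact (h'.2.1 h.2.1).elim
  · exact (h.1 h'.1).elim
  · exact (h.2.1 h'.2.1).elim
  · exact h.2.2.trans h'.2.2.symm

/-- The anchor is joined to the head of the outgoing arc by uni-directional canonical edges. -/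
theorem IsAnchor.uni_path (hP : GeneralPosition P) (hD : IsYaoDigraph D) {i : Fin 4} {u v t : P}
    (h : IsAnchor D i u v) (ht : FanMem D i u t) (hut : D u t) :
    v = t ∨ ∃ s, PathStart D s i u v t := by
  have hv := h.fanMem hP hD
  obtain h | ⟨-, t', ht', hut', h⟩ := h.cases hP hD
  · left
    by_contra hne
    exact h.2.1 ⟨v, t, hne, hv, ht⟩
  obtain rfl := out_unique hD ht.2 ht'.2 hut hut'
  obtain h | h | h := h
  · exact Or.inr ⟨_, h.2⟩
  · exact Or.inr ⟨_, h.2.2⟩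
  · exact Or.inl h.2.2

/-- No uni-directional canonical edge ends at an extreme anchor. -/
theorem IsAnchor.not_uniInto (hP : GeneralPosition P) (hD : IsYaoDigraph D) {s : Bool} {i : Fin 4}
    {u v y : P} (h : IsAnchor D i u v) (hy : OrNext D s i u y v) (hl : OrLast D s i u v)
    (hu : UniArc D y v) : False := by
  have key : ∀ s' t, FanMem D i u t → PathStart D s' i u v t → False := by
    intro s' t ht hs
    by_cases hss : s' = s
    · subst hss
      exact not_lt.2 (hl.2 t ht) hs.2.1
    · obtain rfl : s' = !s := by cases s <;> cases s' <;> simp_all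
      -- The path from `v` now begins with the edge to its neighbour `y`, oriented away from `v`,
      -- against `hu`.
      have hvy := (orNext_not hP hD s).2 hy
      obtain ⟨y', hvy', hle⟩ := exists_orNext hs.1 ht hs.2.1
      obtain rfl := orNext_unique_right hP hvy hvy'
      exact hu.2 (hs.2.2.1 v y hvy le_rfl hle).1
  obtain h | ⟨-, t, ht, -, h | h | ⟨h1, h2, rfl⟩⟩ := h.cases hP hD
  · exact h.2.1 ⟨y, v, fun e => lt_irrefl _ (e ▸ hy.2.2.1), hy.1, hy.2.1⟩
  · exact key _ t ht h.2
  · exact key _ t ht h.2.2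
  · cases s
    · exact h2 ⟨y, hy, hu⟩
    · exact h1 ⟨y, hy, hu⟩

/-! ### Weak anchor chains -/

theorem altCone_succ (i : Fin 4) (l : ℕ) : altCone i (l + 1) = altCone i l + 2 := by
  unfold altCone
  by_cases h : Even l
  · rw [if_pos h, if_neg (by simpa [Nat.even_add_one] using h)]
  · rw [if_neg h, if_pos (by simpa [Nat.even_add_one] using h), fin4_add_two_add_two]

theorem altCone_succ' (i : Fin 4) (l : ℕ) : altCone i (l + 1) = altCone (i + 2) l := by
  induction l with
  | zero => exact altCone_succ i 0
  | succ l ih => rw [altCone_succ, ih, ← altCone_succ]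

theorem dInf_comm (u v : Pt) : dInf u v = dInf v u := by
  simp only [dInf, abs_sub_comm]

theorem dInf_eq_max (s : Bool) {i : Fin 4} {u v : P} (h : InCone i u v) :
    dInf u v = max (orCoord s i v - orCoord s i u) (orCoord (!s) i v - orCoord (!s) i u) := by
  obtain ⟨h1, h2⟩ := (inCone_iff_orCoord s).1 h
  rw [← abs_of_pos (sub_pos.2 h1), ← abs_of_pos (sub_pos.2 h2), abs_sub_comm,
    abs_sub_comm (orCoord (!s) i v), dInf_eq i]
  cases s
  · rw [max_comm]; rfl
  · rfl

theorem dInf_le_of_arc (hD : IsYaoDigraph D) {i : Fin 4} {u v w : P} (hv : InCone i u v)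
    (hw : InCone i u w) (h : D u v) : dInf u v ≤ dInf u w := by
  obtain ⟨j, hj, hmin⟩ := hD.nearest u v h
  obtain rfl := inCone_unique hv hj
  exact hmin w hw

/-- A zigzag path with alternating cones, whose edges all have the same `L_∞`-length, drifts in one
direction. -/
theorem zigzag_false (hP : GeneralPosition P) {i : Fin 4} {r : ℝ} (w : ℕ → P)
    (hcone : ∀ l, InCone (altCone i l) (w l) (w (l + 1))) (hr : ∀ l, dInf (w l) (w (l + 1)) = r)
    (hne : ∀ l, w (l + 2) ≠ w l) : False := by
  have hup : ∀ m, InCone i (w (2 * m)) (w (2 * m + 1)) := by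
    intro m
    have := hcone (2 * m)
    rwa [altCone, if_pos (even_two_mul m)] at this
  have hdown : ∀ m, InCone i (w (2 * m + 2)) (w (2 * m + 1)) := by
    intro m
    have := hcone (2 * m + 1)
    rwa [altCone, if_neg (by simp), inCone_swap] at this
  obtain ⟨s, h0⟩ : ∃ s, orCoord s i (w 1) - orCoord s i (w 0) = r := by
    have := dInf_eq_max true (hup 0)
    rw [hr] at this
    rcases max_choice (orCoord true i (w 1) - orCoord true i (w 0))
      (orCoord false i (w 1) - orCoord false i (w 0)) with h | h
    · exact ⟨true, h.symm.trans this.symm⟩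
    · exact ⟨false, h.symm.trans this.symm⟩
  have step : ∀ m, orCoord s i (w (2 * m + 1)) - orCoord s i (w (2 * m)) = r →
      orCoord s i (w (2 * m + 3)) - orCoord s i (w (2 * m + 2)) = r ∧
      orCoord s i (w (2 * m)) < orCoord s i (w (2 * m + 2)) := by
    intro m hm
    have e1 := dInf_eq_max s (hdown m)
    rw [dInf_comm, hr (2 * m + 1)] at e1
    have e2 := dInf_eq_max s (hup (m + 1))
    rw [hr (2 * (m + 1))] at e2
    change r = max (orCoord s i (w (2 * m + 3)) - orCoord s i (w (2 * m + 2)))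
      (orCoord (!s) i (w (2 * m + 3)) - orCoord (!s) i (w (2 * m + 2))) at e2
    have n1 := hne (2 * m)
    have n2 := hne (2 * m + 1)
    have l1 := e1.symm.le
    have l2 := e2.symm.le
    rw [max_le_iff] at l1 l2
    -- The preceding edge attains `r` in the coordinate `s`. Were this one to do so as well, `w (2 *
    -- m)` and `w (2 * m + 2)` would share that coordinate and coincide.
    have hy : orCoord (!s) i (w (2 * m + 1)) - orCoord (!s) i (w (2 * m + 2)) = r := by
      rcases max_choice (orCoord s i (w (2 * m + 1)) - orCoord s i (w (2 * m + 2)))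
        (orCoord (!s) i (w (2 * m + 1)) - orCoord (!s) i (w (2 * m + 2))) with h | h
      · rw [h] at e1
        exact (n1 (orCoord_injective hP s i _ _ (by linarith))).elim
      · rw [h] at e1; exact e1.symm
    constructor
    · rcases max_choice (orCoord s i (w (2 * m + 3)) - orCoord s i (w (2 * m + 2)))
        (orCoord (!s) i (w (2 * m + 3)) - orCoord (!s) i (w (2 * m + 2))) with h | h
      · rw [h] at e2; exact e2.symm
      · rw [h] at e2
        exact (n2 (orCoord_injective hP (!s) i _ _ (by linarith))).elim
    · refine lt_of_le_of_ne (by linarith) fun h => n1 (orCoord_injective hP s i _ _ h.symm)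
  have hall : ∀ m, orCoord s i (w (2 * m + 1)) - orCoord s i (w (2 * m)) = r := by
    intro m
    induction m with
    | zero => exact h0
    | succ m ih => exact (step m ih).1
  have hmono : StrictMono fun m => orCoord s i (w (2 * m)) :=
    strictMono_nat_of_lt_succ fun m => (step m (hall m)).2
  exact not_injective_infinite_finite (fun m => w (2 * m))
    fun a b h => hmono.injective (congrArg (orCoord s i) h)

theorem eventually_const {α : Type*} [Finite α] (g : α → ℝ) (f : ℕ → α)
    (h : Monotone (g ∘ f) ∨ Antitone (g ∘ f)) : ∃ N r, ∀ l, N ≤ l → g (f l) = r := by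
  have hfin : (Set.range (g ∘ f)).Finite := (Set.toFinite (Set.range g)).subset
    (Set.range_comp_subset_range f g)
  rcases h with h | h
  · obtain ⟨_, ⟨N, rfl⟩, hN⟩ := Set.exists_max_image _ id hfin ⟨_, 0, rfl⟩
    exact ⟨N, _, fun l hl => le_antisymm (hN _ ⟨l, rfl⟩) (h hl)⟩
  · obtain ⟨_, ⟨N, rfl⟩, hN⟩ := Set.exists_min_image _ id hfin ⟨_, 0, rfl⟩
    exact ⟨N, _, fun l hl => le_antisymm (h hl) (hN _ ⟨l, rfl⟩)⟩

/-- Once an edge of the sequence is not an arc in the direction of travel, uniqueness of outgoing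
arcs makes all later edges arcs against it. So the `L_∞`-lengths are eventually monotone, hence
eventually constant on the finite set, and `zigzag_false` applies. -/
theorem no_infinite_weak (hP : GeneralPosition P) (hD : IsYaoDigraph D) {i : Fin 4} (w : ℕ → P)
    (hw : ∀ l, WeakAnchor D (altCone i l) (w l) (w (l + 1))) : False := by
  have hmem : ∀ l, FanMem D (altCone i l) (w l) (w (l + 1)) := fun l => (hw l).1.fanMem hP hD
  have hback : ∀ l, InCone (altCone i (l + 1)) (w (l + 1)) (w l) := fun l => by
    rw [altCone_succ, inCone_swap]; exact (hmem l).2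
  have hne : ∀ l, w (l + 2) ≠ w l := by
    intro l
    obtain ⟨-, z, hz, hne⟩ := hw l
    rw [← altCone_succ] at hz
    exact (hw (l + 1)).1.unique hP hD hz ▸ hne
  obtain ⟨N, hN⟩ : ∃ N, Monotone (fun l => dInf (w (N + l)) (w (N + l + 1))) ∨
      Antitone (fun l => dInf (w (N + l)) (w (N + l + 1))) := by
    by_cases hall : ∀ l, D (w l) (w (l + 1))
    · refine ⟨0, Or.inr (antitone_nat_of_succ_le fun l => ?_)⟩
      simp only [zero_add]
      rw [dInf_comm (w l)]
      exact dInf_le_of_arc hD (hmem (l + 1)).2 (hback l) (hall (l + 1))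
    · push Not at hall
      obtain ⟨N, hN⟩ := hall
      have hrev : ∀ l, D (w (N + l + 1)) (w (N + l)) := by
        intro l
        have : ¬ D (w (N + l)) (w (N + l + 1)) := by
          induction l with
          | zero => exact hN
          | succ l ih =>
            intro h
            exact hne (N + l) (out_unique hD (hmem (N + l + 1)).2 (hback (N + l)) h
              ((hmem (N + l)).arc.resolve_left ih))
        exact (hmem (N + l)).arc.resolve_left this
      refine ⟨N, Or.inl (monotone_nat_of_le_succ fun l => ?_)⟩
      rw [dInf_comm (w (N + l))]
      exact dInf_le_of_arc hD (hback (N + l)) (hmem (N + l + 1)).2 (hrev l)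
  obtain ⟨M, r, hr⟩ := eventually_const (fun p : P × P => dInf p.1 p.2)
    (fun l => (w (N + l), w (N + l + 1))) hN
  have halt : ∀ k l, altCone i (k + l) = altCone (altCone i k) l := by
    intro k l
    induction l with
    | zero => rfl
    | succ l ih => rw [← add_assoc, altCone_succ, ih, ← altCone_succ]
  refine zigzag_false hP (i := altCone i (N + M)) (r := r) (fun l => w (N + M + l)) ?_ ?_ ?_
  · intro l
    rw [← halt]
    exact (hmem _).2
  · intro l
    have := hr (M + l) (Nat.le_add_right _ _)
    simpa only [add_assoc] using this
  · intro l; exact hne _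

/-- The anchors that follow each other in a weak anchor chain. -/
def WeakStep (D : P → P → Prop) (a b : Fin 4 × P) : Prop :=
  b.1 = a.1 + 2 ∧ WeakAnchor D a.1 a.2 b.2

theorem weakStep_wf (hP : GeneralPosition P) (hD : IsYaoDigraph D) :
    WellFounded (fun b a => WeakStep D a b) := by
  rw [wellFounded_iff_isEmpty_descending_chain]
  refine ⟨fun ⟨f, hf⟩ => no_infinite_weak hP hD (i := (f 0).1) (fun l => (f l).2) fun l => ?_⟩
  have : altCone (f 0).1 l = (f l).1 := by
    induction l with
    | zero => rfl
    | succ l ih => rw [altCone_succ, ih, (hf l).1]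
  rw [this]
  exact (hf l).2

/-- Forward termination excludes cycles, and an acyclic relation on a finite type is well-founded in
both directions. This is what allows a chain to be extended back to a start. -/
theorem weakStep_wf' (hP : GeneralPosition P) (hD : IsYaoDigraph D) :
    WellFounded (WeakStep D) := by
  have h := (weakStep_wf hP hD).transGen
  have hirr : ∀ a, ¬ Relation.TransGen (WeakStep D) a a := by
    intro a ha
    rw [← Relation.transGen_swap] at ha
    exact h.irrefl.irrefl a ha
  have : WellFounded (Relation.TransGen (WeakStep D)) :=
    @Finite.wellFounded_of_trans_of_irrefl _ _ _ ⟨fun _ _ _ => Relation.TransGen.trans⟩ ⟨hirr⟩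
  exact Subrelation.wf (fun h => Relation.TransGen.single h) this

/-- The anchors `(w l, w (l + 1))` are weak for `l < k` and strong for `l = k`. -/
def WeakRun (D : P → P → Prop) (i : Fin 4) (k : ℕ) (w : ℕ → P) : Prop :=
  (∀ l < k, WeakAnchor D (altCone i l) (w l) (w (l + 1))) ∧
    StrongAnchor D (altCone i k) (w k) (w (k + 1))

/-- Put `a` in front of a sequence. -/
def seqCons (a : P) (w : ℕ → P) : ℕ → P
  | 0 => a
  | n + 1 => w n

theorem WeakRun.cons {i : Fin 4} {k : ℕ} {w : ℕ → P} {u : P} (h : WeakRun D (i + 2) k w)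
    (hu : WeakAnchor D i u (w 0)) : WeakRun D i (k + 1) (seqCons u w) := by
  constructor
  · rintro (_ | l) hl
    · exact hu
    · rw [altCone_succ']
      exact h.1 l (by omega)
  · rw [altCone_succ']
    exact h.2

theorem IsAnchor.strong_or_weak {i : Fin 4} {u v : P} (h : IsAnchor D i u v) :
    StrongAnchor D i u v ∨ WeakAnchor D i u v := by
  by_cases hs : ∀ w, IsAnchor D (i + 2) v w → w = u
  · exact Or.inl ⟨h, hs⟩
  · push Not at hs
    exact Or.inr ⟨h, hs⟩

theorem exists_weakRun (hP : GeneralPosition P) (hD : IsYaoDigraph D) (a : Fin 4 × P) :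
    ∀ v, IsAnchor D a.1 a.2 v → ∃ k w, WeakRun D a.1 k w ∧ w 0 = a.2 ∧ w 1 = v := by
  induction a using (weakStep_wf hP hD).induction with
  | _ a ih =>
    intro v hv
    rcases hv.strong_or_weak with h | h
    · exact ⟨0, seqCons a.2 fun _ => v, ⟨fun l hl => absurd hl (Nat.not_lt_zero l), h⟩, rfl, rfl⟩
    · obtain ⟨-, z, hz, -⟩ := id h
      obtain ⟨k, w, hw, h0, -⟩ := ih (a.1 + 2, v) ⟨rfl, h⟩ z hz
      exact ⟨k + 1, seqCons a.2 w, hw.cons (h0 ▸ h), rfl, h0⟩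

theorem WeakRun.isWeakChain {i : Fin 4} {k : ℕ} {w : ℕ → P} (h : WeakRun D i k w) (hk : 1 ≤ k)
    (hs : ∀ z, ¬ WeakAnchor D (i + 2) z (w 0)) : IsWeakChain D i k w :=
  ⟨hk, h.1, ⟨_, h.2⟩, hs⟩

theorem WeakRun.extend (hP : GeneralPosition P) (hD : IsYaoDigraph D) (a : Fin 4 × P) :
    ∀ k w, 1 ≤ k → WeakRun D a.1 k w → w 0 = a.2 →
      ∃ j n w', IsWeakChain D j (n + k) w' ∧ altCone j n = a.1 ∧ ∀ l, w' (n + l) = w l := by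
  induction a using (weakStep_wf' hP hD).induction with
  | _ a ih =>
    intro k w hk hw h0
    by_cases hz : ∃ z, WeakAnchor D (a.1 + 2) z (w 0)
    · obtain ⟨z, hz⟩ := hz
      have hw' : WeakRun D (a.1 + 2 + 2) k w := by rwa [fin4_add_two_add_two]
      obtain ⟨j, n, w', h1, h2, h3⟩ := ih (a.1 + 2, z)
        ⟨(fin4_add_two_add_two _).symm, h0 ▸ hz⟩ (k + 1) (seqCons z w) (by omega)
        (hw'.cons hz) rfl
      refine ⟨j, n + 1, w', by rwa [add_right_comm], ?_, fun l => ?_⟩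
      · rw [altCone_succ, h2, fin4_add_two_add_two]
      · rw [add_right_comm]; exact h3 (l + 1)
    · push Not at hz
      exact ⟨a.1, 0, w, by rw [zero_add]; exact hw.isWeakChain hk hz, rfl,
        fun l => by rw [zero_add]⟩

theorem WeakRun.selected (hP : GeneralPosition P) (hD : IsYaoDigraph D) {i : Fin 4} {k : ℕ}
    {w : ℕ → P} (h : WeakRun D i k w) (hk : Even k) : SelectedAnchor D i (w 0) (w 1) := by
  rcases Nat.eq_zero_or_pos k with rfl | hpos
  · exact Or.inl h.2
  · obtain ⟨j, n, w', h1, h2, h3⟩ := WeakRun.extend hP hD (i, w 0) k w hpos h rfl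
    obtain ⟨m, hm⟩ := hk
    -- Here `k = m + m` is positive, so `n + 2 + 2 * (m - 1) = n + k`: position `n` has the parity
    -- that is selected, however far back the chain was extended.
    exact Or.inr ⟨j, n + k, w', h1, n, m - 1, by omega, h2.symm, (h3 0).symm, (h3 1).symm⟩

/-- If an anchor is not selected, then it is weak and the next anchor is selected. -/
theorem IsAnchor.of_not_selected (hP : GeneralPosition P) (hD : IsYaoDigraph D) {i : Fin 4}
    {u v : P} (h : IsAnchor D i u v) (hs : ¬ SelectedAnchor D i u v) :
    ∃ w, SelectedAnchor D (i + 2) v w ∧ IsAnchor D (i + 2) v w ∧ w ≠ u := by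
  obtain ⟨k, w, hw, rfl, rfl⟩ := exists_weakRun hP hD (i, u) v h
  obtain _ | k := k
  · exact (hs (hw.selected hP hD Even.zero)).elim
  · have hweak := hw.1 0 (Nat.succ_pos k)
    have hw' : WeakRun D (i + 2) k (fun l => w (l + 1)) := by
      constructor
      · intro l hl
        rw [← altCone_succ']
        exact hw.1 (l + 1) (by omega)
      · rw [← altCone_succ']
        exact hw.2
    have hk : Even k := by
      by_contra hk
      exact hs (hw.selected hP hD (by simpa [Nat.even_add_one] using hk))
    obtain ⟨-, z, hz, hne⟩ := hweak
    have h1 : IsAnchor D (i + 2) (w 1) (w 2) := by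
      rcases Nat.eq_zero_or_pos k with rfl | hpos
      · exact hw'.2.1
      · exact (hw'.1 0 hpos).1
    exact ⟨w 2, hw'.selected hP hD hk, h1, h1.unique hP hD hz ▸ hne⟩

theorem IsAnchor.startOfOddChain (hP : GeneralPosition P) (hD : IsYaoDigraph D) {i : Fin 4}
    {u v : P} (h : IsAnchor D i u v) (hs : ¬ SelectedAnchor D i u v)
    (hz : ∀ z, ¬ WeakAnchor D (i + 2) z u) : StartOfOddChain D i u v := by
  obtain ⟨k, w, hw, rfl, rfl⟩ := exists_weakRun hP hD (i, u) v h
  have hk : Odd k := by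
    rw [← Nat.not_even_iff_odd]
    exact fun hk => hs (hw.selected hP hD hk)
  exact ⟨k, w, hw.isWeakChain hk.pos hz, hk, rfl, rfl⟩

theorem SelectedAnchor.isAnchor {i : Fin 4} {u v : P} (h : SelectedAnchor D i u v) :
    IsAnchor D i u v := by
  obtain h | ⟨j, k, w, hw, n, m, hk, rfl, rfl, rfl⟩ := h
  · exact h.1
  · exact (hw.weak n (by omega)).1

theorem WeakAnchor.fanMulti (hP : GeneralPosition P) (hD : IsYaoDigraph D) {i : Fin 4} {u v : P}
    (h : WeakAnchor D i u v) : FanMulti D i u ∧ FanMulti D (i + 2) v := by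
  obtain ⟨ha, w, hw, hne⟩ := h
  have hm : FanMulti D (i + 2) v := ⟨w, u, hne, hw.fanMem hP hD, (ha.fanMem hP hD).symm⟩
  refine ⟨?_, hm⟩
  obtain h | h := ha.cases hP hD
  · exact (h.2.2 hm).elim
  · exact h.1

/-! ### Edges of `H₈` -/

theorem h8_of_selected (hP : GeneralPosition P) (hD : IsYaoDigraph D) {i : Fin 4} {a b : P}
    (h : SelectedAnchor D i a b) : (H8 D).Adj a b := by
  rw [H8, SimpleGraph.fromRel_adj]
  exact ⟨(h.isAnchor.fanMem hP hD).2.ne, Or.inl (Or.inl ⟨i, h⟩)⟩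

/-- The uni-directional canonical edge from `a` to the extreme member `b` of a fan is excepted. -/
def Excepted (D : P → P → Prop) (s : Bool) (i : Fin 4) (u a b : P) : Prop :=
  OrNext D s i u a b ∧ OrLast D s i u b ∧ FanMulti D (i + 2) b ∧
    ¬ StartOfOddChain D (i + 2) b u ∧ UniArc D a b

/-- An exception applies only to an edge oriented towards the extreme member, so just one of the two
can concern an edge from `a` to `b`. `Excepted` forgets the clause about anchors, which only
enlarges the set of edges to be replaced. -/
theorem h8_or_excepted (hP : GeneralPosition P) (hD : IsYaoDigraph D) {s : Bool} {i : Fin 4}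
    {u a b : P} (h : OrNext D s i u a b) (hu : UniArc D a b) :
    (H8 D).Adj a b ∨ Excepted D s i u a b := by
  by_cases hE : Excepted D s i u a b
  · exact Or.inr hE
  left
  rw [H8, SimpleGraph.fromRel_adj]
  refine ⟨(h.inCone hP hD).ne, ?_⟩
  cases s
  · refine Or.inr (Or.inr ⟨i, u, (fanNext_iff' hP hD).2 h, Or.inr hu, ?_, ?_⟩)
    · rintro ⟨-, h1, h2, h3, -, -⟩
      exact hE ⟨h, (fanFirst_iff hP hD).1 h1, h2.2.2, h3, hu⟩
    · rintro ⟨-, -, -, -, -, h6⟩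
      exact h6.2 hu.1
  · refine Or.inl (Or.inr ⟨i, u, (fanNext_iff hP hD).2 h, Or.inl hu, ?_, ?_⟩)
    · rintro ⟨-, -, -, -, -, h6⟩
      exact h6.2 hu.1
    · rintro ⟨-, h1, h2, h3, -, -⟩
      exact hE ⟨h, (fanLast_iff hP hD).1 h1, h2.2.2, h3, hu⟩

theorem canonical_cases (hP : GeneralPosition P) (hD : IsYaoDigraph D) {s : Bool} {i : Fin 4}
    {u a b : P} (h : OrNext D s i u a b) :
    (D a b ∧ D b a) ∨ (H8 D).Adj a b ∨ Excepted D s i u a b ∨ Excepted D (!s) i u b a := by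
  by_cases h1 : D a b <;> by_cases h2 : D b a
  · exact Or.inl ⟨h1, h2⟩
  · obtain h | h := h8_or_excepted hP hD h ⟨h1, h2⟩
    · exact Or.inr (Or.inl h)
    · exact Or.inr (Or.inr (Or.inl h))
  · obtain h | h := h8_or_excepted hP hD ((orNext_not hP hD s).2 h) ⟨h2, h1⟩
    · exact Or.inr (Or.inl h.symm)
    · exact Or.inr (Or.inr (Or.inr h))
  · exact ((h.arc_or hP hD).elim h1 h2).elim

/-! ### Canonical paths -/

/-- `(a, b)` is an edge of the canonical path from `v` to `w`, which runs in the orientation `s`. -/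
def Segment (D : P → P → Prop) (s : Bool) (i : Fin 4) (u v w a b : P) : Prop :=
  OrNext D s i u a b ∧ orCoord s i a ≤ orCoord s i v ∧ orCoord s i w ≤ orCoord s i b

theorem exists_segment_list (hP : GeneralPosition P) {s : Bool} {i : Fin 4} {u w : P}
    (hw : FanMem D i u w) : ∀ v, FanMem D i u v → orCoord s i w ≤ orCoord s i v →
      ∃ q : List P, q.head? = some v ∧ q.getLast? = some w ∧ q.IsChain (Segment D s i u v w) := by
  have wf : WellFounded (fun a b : P => orCoord s i a < orCoord s i b) :=
    @Finite.wellFounded_of_trans_of_irrefl _ _ _ ⟨fun _ _ _ h1 h2 => h1.trans h2⟩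
      ⟨fun _ => lt_irrefl _⟩
  intro v
  induction v using wf.induction with
  | _ v ih =>
    intro hv hle
    rcases hle.eq_or_lt with h | h
    · obtain rfl := orCoord_injective hP _ _ _ _ h
      exact ⟨[w], rfl, rfl, List.isChain_singleton _⟩
    · obtain ⟨b, hb, hwb⟩ := exists_orNext hv hw h
      obtain ⟨q, h1, h2, h3⟩ := ih b hb.2.2.1 hb.2.1 hwb
      refine ⟨v :: q, rfl, by rw [List.getLast?_cons, h2]; rfl, List.isChain_cons.2 ⟨?_, ?_⟩⟩
      · intro c hc
        obtain rfl : b = c := by rw [h1] at hc; simpa using hc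
        exact ⟨hb, le_rfl, hwb⟩
      · exact h3.imp fun c d h => ⟨h.1, h.2.1.trans hb.2.2.1.le, h.2.2⟩

theorem exists_canPath (hP : GeneralPosition P) (hD : IsYaoDigraph D) {i : Fin 4} {u v w : P}
    (hv : FanMem D i u v) (hw : FanMem D i u w) :
    ∃ q, CanPath D i u v w q ∧ q.IsChain fun a b => ∃ s, Segment D s i u v w a b := by
  obtain ⟨s, hs⟩ : ∃ s, orCoord s i w ≤ orCoord s i v := by
    rcases le_total (orCoord true i w) (orCoord true i v) with h | h
    · exact ⟨true, h⟩
    · exact ⟨false, not_lt.1 fun h' => not_lt.2 h ((orCoord_not_lt hP hD true hv hw).1 h')⟩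
  obtain ⟨q, h1, h2, h3⟩ := exists_segment_list hP hw v hv hs
  exact ⟨q, (canPath_iff hP hD).2 ⟨hv, hw, h1, h2, s, h3.imp fun _ _ h => h.1⟩,
    h3.imp fun _ _ h => ⟨s, h⟩⟩

theorem CanPath.reverse {i : Fin 4} {u v w : P} {q : List P} (h : CanPath D i u v w q) :
    CanPath D i u w v q.reverse := by
  obtain ⟨h1, h2, h3, h4, h5⟩ := h
  refine ⟨h2, h1, by rwa [List.head?_reverse], by rwa [List.getLast?_reverse], ?_⟩
  rw [List.isChain_reverse, List.isChain_reverse]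
  exact h5.symm

theorem Segment.eq_of_last (hP : GeneralPosition P) {s : Bool} {i : Fin 4} {u v w a b : P}
    (h : Segment D s i u v w a b) (hw : FanMem D i u w) (hb : OrLast D s i u b) : b = w :=
  orCoord_injective hP _ _ _ _ (le_antisymm (hb.2 w hw) h.2.2)

theorem Segment.eq_of_first (hP : GeneralPosition P) (hD : IsYaoDigraph D) {s : Bool} {i : Fin 4}
    {u v w a b : P} (h : Segment D s i u v w a b) (hv : FanMem D i u v)
    (ha : OrLast D (!s) i u a) : a = v := by
  refine orCoord_injective hP _ _ _ _ (le_antisymm h.2.1 (not_lt.1 fun hlt => ?_))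
  exact not_lt.2 (ha.2 v hv) ((orCoord_not_lt hP hD s hv ha.1).2 hlt)

/-- The canonical edges between the anchor and the head of the outgoing arc are uni-directional. -/
theorem IsAnchor.segment_uni (hP : GeneralPosition P) (hD : IsYaoDigraph D) {s : Bool} {i : Fin 4}
    {u v t a b : P} (h : IsAnchor D i u v) (ht : FanMem D i u t) (hut : D u t)
    (hs : Segment D s i u v t a b) : UniArc D a b := by
  obtain ⟨hab, h1, h2⟩ := hs
  have hlt : orCoord s i t < orCoord s i v := by linarith [hab.2.2.1]
  obtain rfl | ⟨s', hs'⟩ := h.uni_path hP hD ht hut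
  · exact (lt_irrefl _ hlt).elim
  · by_cases hss : s' = s
    · subst hss
      exact hs'.2.2.1 a b hab h1 h2
    · obtain rfl : s' = !s := by cases s <;> cases s' <;> simp_all
      exact (lt_asymm hlt ((orCoord_not_lt hP hD s ht hs'.1).1 hs'.2.1)).elim

/-! ### Standard paths towards an edge that is alone in its opposite cone -/

section lonely

variable {s : Bool} {i : Fin 4} {u e v : P}

/-- An anchor that is not selected is weak, hence dual, and so is a weak anchor `(z, u)` preceding
it. Then `v`, `z` and `e` would be distinct members of one fan with `e` extreme; whichever of `v`
and `z` lies in the middle cannot be dual. -/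
theorem startOfOddChain_of_lonely (hP : GeneralPosition P) (hD : IsYaoDigraph D)
    (he : OrLast D s i u e) (hsing : ∀ z, FanMem D (i + 2) e z → z = u) (hv : IsAnchor D i u v)
    (hns : ¬ SelectedAnchor D i u v) : StartOfOddChain D i u v := by
  obtain ⟨w, -, hw, hwu⟩ := hv.of_not_selected hP hD hns
  have hvm := hv.fanMem hP hD
  have hwm := hw.fanMem hP hD
  refine hv.startOfOddChain hP hD hns fun z hz => ?_
  have hzm := (hz.1.fanMem hP hD).symm'
  obtain ⟨y, hyu, hy⟩ := (hz.fanMulti hP hD).1.exists_ne u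
  have hzv : z ≠ v := by
    rintro rfl
    exact hwu (hw.unique hP hD hz.1)
  have hlt : ∀ c, FanMem D i u c → (∃ d, d ≠ u ∧ FanMem D (i + 2) c d) →
      orCoord s i e < orCoord s i c := by
    rintro c hc ⟨d, hdu, hd⟩
    refine lt_of_le_of_ne (he.2 c hc) fun h => hdu (hsing d ?_)
    rwa [orCoord_injective hP _ _ _ _ h]
  have hev := hlt v hvm ⟨w, hwu, hwm⟩
  have hez := hlt z hzm ⟨y, hyu, hy⟩
  rcases lt_trichotomy (orCoord s i v) (orCoord s i z) with h | h | h
  · exact hwu (single_of_between hP hD hzm hvm he.1 h hev hwm)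
  · exact hzv (orCoord_injective hP _ _ _ _ h).symm
  · exact hyu (single_of_between hP hD hvm hzm he.1 h hez hy)

/-- An exception needs an edge directed into an extreme member of the fan, which can only be an end
of the segment. At `e` it would require a second opposite edge; at `v` no uni-directional edge
enters an extreme anchor. -/
theorem segment_cases_of_lonely (hP : GeneralPosition P) (hD : IsYaoDigraph D)
    (he : OrLast D s i u e) (hsing : ∀ z, FanMem D (i + 2) e z → z = u) (hv : IsAnchor D i u v)
    {s' : Bool} {a b : P} (hs : Segment D s' i u v e a b) :
    (D a b ∧ D b a) ∨ (H8 D).Adj a b := by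
  obtain h | h | h | h := canonical_cases hP hD hs.1
  · exact Or.inl h
  · exact Or.inr h
  · exfalso
    obtain rfl := hs.eq_of_last hP he.1 h.2.1
    obtain ⟨y, hy, hym⟩ := h.2.2.1.exists_ne u
    exact hy (hsing y hym)
  · exfalso
    obtain rfl := hs.eq_of_first hP hD (hv.fanMem hP hD) h.2.1
    exact hv.not_uniInto hP hD h.1 h.2.1 h.2.2.2.2

/-- At the end `u` the exception is waived because `(u, v)` is a start-of-odd-chain anchor; the end
`w` is again an anchor. -/
theorem next_segment_cases_of_lonely (hP : GeneralPosition P) (hD : IsYaoDigraph D)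
    (he : OrLast D s i u e) (hsing : ∀ z, FanMem D (i + 2) e z → z = u) (hv : IsAnchor D i u v)
    (hns : ¬ SelectedAnchor D i u v) {w : P} (hw : IsAnchor D (i + 2) v w) {s' : Bool} {a b : P}
    (hs : Segment D s' (i + 2) v w u a b) : (D a b ∧ D b a) ∨ (H8 D).Adj a b := by
  obtain h | h | h | h := canonical_cases hP hD hs.1
  · exact Or.inl h
  · exact Or.inr h
  · exfalso
    obtain rfl := hs.eq_of_last hP (hv.fanMem hP hD).symm h.2.1
    have := h.2.2.2.1
    rw [fin4_add_two_add_two] at this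
    exact this (startOfOddChain_of_lonely hP hD he hsing hv hns)
  · exfalso
    obtain rfl := hs.eq_of_first hP hD (hw.fanMem hP hD) h.2.1
    exact hw.not_uniInto hP hD h.1 h.2.1 h.2.2.2.2

end lonely

/-! ### Construction of standard paths -/

theorem reverseEdges_reverseEdges (E : List (P × P)) : reverseEdges (reverseEdges E) = E := by
  simp [reverseEdges, List.map_reverse]

theorem IsPathIn.reverse {H : SimpleGraph P} {u v : P} {E : List (P × P)} (h : IsPathIn H u v E) :
    IsPathIn H v u (reverseEdges E) := by
  obtain ⟨w, rfl⟩ := h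
  refine ⟨w.reverse, ?_⟩
  simp [reverseEdges, List.map_reverse, Function.comp_def]

theorem exists_splice {H : SimpleGraph P} {B : P → P → List (P × P) → Prop} {R : P → P → Prop}
    (hR : ∀ a b, R a b → ∃ F, B a b F ∧ IsPathIn H a b F) (p : List P) :
    ∀ {u v : P}, p.head? = some u → p.getLast? = some v → p.IsChain R →
      ∃ E, Splice B p E ∧ IsPathIn H u v E := by
  induction p with
  | nil => intro u v h; simp at h
  | cons a p ih =>
    intro u v hu hv hc
    obtain rfl : a = u := by simpa using hu
    cases p with
    | nil =>
      obtain rfl : a = v := by simpa using hv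
      exact ⟨[], Splice.single a, SimpleGraph.Walk.nil, rfl⟩
    | cons b p =>
      rw [List.isChain_cons_cons] at hc
      obtain ⟨F, hF, w1, rfl⟩ := hR a b hc.1
      obtain ⟨E, hE, w2, rfl⟩ := ih rfl (by simpa using hv) hc.2
      exact ⟨_, Splice.cons a b p _ _ hF hE, w1.append w2, by simp⟩

/-- There is a `2d`-standard path in `H₈` from `u` to `v`. -/
def HasStandardPath (D : P → P → Prop) (d : ℕ) (u v : P) : Prop :=
  ∃ E, IsStandardPath D (H8 D) d u v E

/-- The edge `(a, b)` is in `H₈` or can be replaced by a `2d`-standard path. -/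
def Replaceable (D : P → P → Prop) (d : ℕ) (a b : P) : Prop :=
  (H8 D).Adj a b ∨ (Canonical D a b ∧ 1 ≤ d ∧ (HasStandardPath D d a b ∨ HasStandardPath D d b a))

theorem Replaceable.symm {d : ℕ} {a b : P} (h : Replaceable D d a b) : Replaceable D d b a := by
  obtain h | ⟨h1, h2, h3⟩ := h
  · exact Or.inl h.symm
  · exact Or.inr ⟨h1.symm, h2, h3.symm⟩

theorem hasStandardPath_of_list {d : ℕ} {u v : P} {p : List P} (h : TwoStandard D u v p)
    (hu : p.head? = some u) (hv : p.getLast? = some v) (hc : p.IsChain (Replaceable D d)) :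
    HasStandardPath D (d + 1) u v := by
  obtain ⟨E, hE, hpath⟩ := exists_splice (H := H8 D)
    (B := fun a b F => ((H8 D).Adj a b ∧ F = [(a, b)]) ∨
        (¬ (H8 D).Adj a b ∧ Canonical D a b ∧ 1 ≤ d ∧
          (PrePath D (H8 D) d a b F ∨ PrePath D (H8 D) d b a (reverseEdges F))) ∨
        (¬ (H8 D).Adj a b ∧ ¬ (Canonical D a b ∧ 1 ≤ d) ∧ F = [])) (fun a b hab => by
      by_cases hadj : (H8 D).Adj a b
      · exact ⟨_, Or.inl ⟨hadj, rfl⟩, hadj.toWalk, by simp⟩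
      · obtain ⟨hcan, hd, ⟨F, hF1, hF2⟩ | ⟨F, hF1, hF2⟩⟩ := hab.resolve_left hadj
        · exact ⟨F, Or.inr (Or.inl ⟨hadj, hcan, hd, Or.inl hF1⟩), hF2⟩
        · exact ⟨reverseEdges F, Or.inr (Or.inl ⟨hadj, hcan, hd,
            Or.inr (by rwa [reverseEdges_reverseEdges])⟩), hF2.reverse⟩) p hu hv hc
  refine ⟨E, ?_, hpath⟩
  rw [PrePath]
  exact ⟨p, h, hE⟩

/-- The hypotheses `h1` and `h2` cover the only canonical segments that occur, one at `u` and, if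
the anchor is not selected, one at `v`. The anchor used is always a selected one, hence in `H₈`. -/
theorem hasStandardPath_of_anchor (hP : GeneralPosition P) (hD : IsYaoDigraph D) {d : ℕ}
    {i : Fin 4} {u e v : P} (he : FanMem D i u e) (hv : IsAnchor D i u v)
    (h1 : ∀ s a b, Segment D s i u v e a b → Replaceable D d a b)
    (h2 : ¬ SelectedAnchor D i u v → ∀ w, IsAnchor D (i + 2) v w → w ≠ u → ∀ s a b,
      Segment D s (i + 2) v w u a b → Replaceable D d a b) :
    HasStandardPath D (d + 1) u e := by
  have hvm := hv.fanMem hP hD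
  obtain ⟨q, hq, hqc⟩ := exists_canPath hP hD hvm he
  replace hqc : q.IsChain (Replaceable D d) := hqc.imp fun a b ⟨s, h⟩ => h1 s a b h
  obtain ⟨-, -, hqh, hql, -⟩ := id hq
  by_cases hs : SelectedAnchor D i u v
  · refine hasStandardPath_of_list (p := u :: q)
      ⟨i, v, he, hv, Or.inl ⟨hs, i, v, q, he, hv, hq, rfl⟩⟩ rfl
      (by rw [List.getLast?_cons, hql]; rfl) (List.isChain_cons.2 ⟨fun c hc => ?_, hqc⟩)
    obtain rfl : v = c := by rw [hqh] at hc; simpa using hc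
    exact Or.inl (h8_of_selected hP hD hs)
  · obtain ⟨w, hsel, hw, hwu⟩ := hv.of_not_selected hP hD hs
    obtain ⟨r, hr, hrc⟩ := exists_canPath hP hD (hw.fanMem hP hD) hvm.symm
    replace hrc : r.IsChain (Replaceable D d) := hrc.imp fun a b ⟨s, h⟩ => h2 hs w hw hwu s a b h
    obtain ⟨-, -, hrh, hrl, -⟩ := id hr
    have hrev : ∀ l : List P, l.IsChain (Replaceable D d) → l.reverse.IsChain (Replaceable D d) := by
      intro l hl
      rw [List.isChain_reverse]
      exact hl.imp fun a b h => h.symm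
    refine hasStandardPath_of_list (p := (q.reverse ++ r).reverse)
      ⟨i, v, he, hv, Or.inr ⟨hs, q.reverse, v :: r, hq.reverse,
        ⟨i + 2, w, r, hvm.symm, hw, hr, rfl⟩, rfl⟩⟩ ?_ ?_ (hrev _ (List.isChain_append.2
        ⟨hrev q hqc, hrc, ?_⟩))
    · rw [List.head?_reverse, List.getLast?_append, hrl]; rfl
    · rw [List.getLast?_reverse, List.head?_append, List.head?_reverse, hql]; rfl
    · intro x hx y hy
      rw [List.getLast?_reverse, hqh] at hx
      rw [hrh] at hy
      obtain rfl : v = x := by simpa using hx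
      obtain rfl : w = y := by simpa using hy
      exact Or.inl (h8_of_selected hP hD hsel)

theorem mutuallySingle_strong {i : Fin 4} (hP : GeneralPosition P) (hD : IsYaoDigraph D) {u v : P}
    (h : MutuallySingle D i u v) : StrongAnchor D i u v := by
  refine ⟨Or.inl h, fun w hw => ?_⟩
  by_contra hne
  exact h.2.2 ⟨w, u, hne, hw.fanMem hP hD, h.1.symm⟩

/-- A bi-directional canonical edge is in `H₈`, or its `2`-standard path is. -/
theorem bidirectional_cases (hP : GeneralPosition P) (hD : IsYaoDigraph D) {s : Bool} {j : Fin 4}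
    {x u e : P} (h : OrNext D s j x u e) (hue : D u e) (heu : D e u)
    (hm : FanMulti D (turn s j) u) : (H8 D).Adj u e ∨ ∀ d, HasStandardPath D (d + 1) u e := by
  have he := h.orLast hP hD
  have hsing : ∀ z, FanMem D (turn s j + 2) e z → z = u := fun z hz =>
    h.opposite_single hP hD hm hz
  obtain ⟨v, hv⟩ := exists_anchor hP hD hm
  by_cases hve : v = e
  · subst hve
    exact Or.inl (h8_of_selected hP hD (Or.inl ⟨hv, fun w hw => hsing w (hw.fanMem hP hD)⟩))
  · refine Or.inr fun d => hasStandardPath_of_anchor hP hD he.1 hv ?_ ?_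
    · intro s' a b hs
      have huni := hv.segment_uni hP hD he.1 hue hs
      obtain h | h := segment_cases_of_lonely hP hD he hsing hv hs
      · exact (huni.2 h.2).elim
      · exact Or.inl h
    · intro hns w hw hwu s' a b hs
      have hvm := hv.fanMem hP hD
      -- The arc out of `u` goes to `e`, so the edge `(u, v)` must come from `v`. Thus `u` is the
      -- head of the arc out of `v`, and the second segment is uni-directional as well.
      have hvu : D v u := hvm.arc.resolve_left fun h' => hve (out_unique hD hvm.2 he.1.2 h' hue)
      have huni := hw.segment_uni hP hD hvm.symm hvu hs
      obtain h | h := next_segment_cases_of_lonely hP hD he hsing hv hns hw hs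
      · exact (huni.2 h.2).elim
      · exact Or.inl h

theorem bidirectional_replaceable (hP : GeneralPosition P) (hD : IsYaoDigraph D) {s : Bool}
    {j : Fin 4} {x a b : P} (h : OrNext D s j x a b) (hab : D a b) (hba : D b a) (d : ℕ) :
    Replaceable D (d + 1) a b := by
  have hcan : Canonical D a b := (canonical_iff hP hD).2 ⟨s, j, x, h⟩
  by_cases ha : FanMulti D (turn s j) a
  · obtain h | h := bidirectional_cases hP hD h hab hba ha
    · exact Or.inl h
    · exact Or.inr ⟨hcan, Nat.succ_pos d, Or.inl (h d)⟩
  · by_cases hb : FanMulti D (turn s j + 2) b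
    · rw [turn_turn] at hb
      obtain h | h := bidirectional_cases hP hD ((orNext_not hP hD s).2 h) hba hab hb
      · exact Or.inl h.symm
      · exact Or.inr ⟨hcan, Nat.succ_pos d, Or.inr (h d)⟩
    · exact Or.inl (h8_of_selected hP hD
        (Or.inl (mutuallySingle_strong hP hD ⟨h.fanMem hP hD, ha, hb⟩)))

theorem Excepted.hasStandardPath (hP : GeneralPosition P) (hD : IsYaoDigraph D) {s : Bool}
    {i : Fin 4} {u a b : P} (h : Excepted D s i u a b) (d : ℕ) :
    HasStandardPath D (d + 2) b a := by
  obtain ⟨hab, -, -, -, huni⟩ := h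
  have hba := (orNext_not hP hD s).2 hab
  have he := hba.orLast hP hD
  have hsing : ∀ z, FanMem D (turn (!s) i + 2) a z → z = b := by
    intro z hz
    rw [turn_turn] at hz
    exact hba.uni_single hP hD huni hz
  obtain ⟨c, ⟨hc, hbc⟩, -⟩ := hD.choice b (turn (!s) i) ⟨a, he.1.2⟩
  -- The arc of `b` in the cone of `a` does not go to `a`, as the edge is uni-directional, so its
  -- head is a second fan member.
  have hm : FanMulti D (turn (!s) i) b :=
    ⟨a, c, fun e => huni.2 (e ▸ hbc), he.1, fanMem_of_arc hc hbc⟩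
  obtain ⟨v, hv⟩ := exists_anchor hP hD hm
  refine hasStandardPath_of_anchor hP hD he.1 hv ?_ ?_
  · intro s' x y hs
    obtain h | h := segment_cases_of_lonely hP hD he hsing hv hs
    · exact bidirectional_replaceable hP hD hs.1 h.1 h.2 d
    · exact Or.inl h
  · intro hns w hw hwu s' x y hs
    obtain h | h := next_segment_cases_of_lonely hP hD he hsing hv hns hw hs
    · exact bidirectional_replaceable hP hD hs.1 h.1 h.2 d
    · exact Or.inl h

theorem canonical_replaceable (hP : GeneralPosition P) (hD : IsYaoDigraph D) {s : Bool}
    {i : Fin 4} {u a b : P} (h : OrNext D s i u a b) (d : ℕ) : Replaceable D (d + 2) a b := by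
  have hcan : Canonical D a b := (canonical_iff hP hD).2 ⟨s, i, u, h⟩
  obtain h' | h' | h' | h' := canonical_cases hP hD h
  · exact bidirectional_replaceable hP hD h h'.1 h'.2 (d + 1)
  · exact Or.inl h'
  · exact Or.inr ⟨hcan, by omega, Or.inr (h'.hasStandardPath hP hD d)⟩
  · exact Or.inr ⟨hcan, by omega, Or.inl (h'.hasStandardPath hP hD d)⟩

theorem exists_standardPath (hP : GeneralPosition P) (hD : IsYaoDigraph D) {u v : P}
    (h : (yaoGraph D).Adj u v) : HasStandardPath D 3 u v ∨ HasStandardPath D 3 v u := by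
  obtain ⟨i, hi⟩ := exists_cone hP h.ne
  have key : ∀ {i u v}, FanMem D i u v → (∃ w, IsAnchor D i u w) → HasStandardPath D 3 u v := by
    rintro i u v hm ⟨w, hw⟩
    exact hasStandardPath_of_anchor hP hD hm hw (fun s a b hs => canonical_replaceable hP hD hs.1 0)
      fun _ w' _ _ s a b hs => canonical_replaceable hP hD hs.1 0
  have hm : FanMem D i u v := ⟨h, hi⟩
  by_cases hu : FanMulti D i u
  · exact Or.inl (key hm (exists_anchor hP hD hu))
  · by_cases hv : FanMulti D (i + 2) v
    · exact Or.inr (key hm.symm (exists_anchor hP hD hv))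
    · exact Or.inl (key hm ⟨v, Or.inl ⟨hm, hu, hv⟩⟩)

/-! ### Euclidean lengths -/

theorem dist_sq (s : Bool) (i : Fin 4) (u v : P) :
    dist u v ^ 2 = (orCoord s i u - orCoord s i v) ^ 2 +
      (orCoord (!s) i u - orCoord (!s) i v) ^ 2 := by
  rw [Subtype.dist_eq, EuclideanSpace.dist_eq, Real.sq_sqrt (by positivity), Fin.sum_univ_two,
    Real.dist_eq, Real.dist_eq, sq_abs, sq_abs]
  cases s <;> fin_cases i <;> simp [orCoord, coneCoord] <;> ring

theorem sub_le_dist (s : Bool) (i : Fin 4) (u v : P) :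
    orCoord s i v - orCoord s i u ≤ dist u v := by
  refine le_of_sq_le_sq ?_ dist_nonneg
  rw [dist_sq s i]
  nlinarith [sq_nonneg (orCoord (!s) i u - orCoord (!s) i v)]

theorem dist_le_add (s : Bool) {i : Fin 4} {u v : P} (h1 : orCoord s i u ≤ orCoord s i v)
    (h2 : orCoord (!s) i u ≤ orCoord (!s) i v) :
    dist u v ≤ (orCoord s i v - orCoord s i u) + (orCoord (!s) i v - orCoord (!s) i u) := by
  refine le_of_sq_le_sq ?_ (by linarith)
  rw [dist_sq s i]
  nlinarith [mul_nonneg (sub_nonneg.2 h1) (sub_nonneg.2 h2)]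

theorem dist_le_of_orNext (hP : GeneralPosition P) (hD : IsYaoDigraph D) {s : Bool} {i : Fin 4}
    {u a b : P} (h : OrNext D s i u a b) :
    dist a b ≤ (orCoord s i a - orCoord s i b) + (orCoord (!s) i b - orCoord (!s) i a) := by
  have h1 := h.2.2.1
  have h2 := (orCoord_not_lt hP hD s h.1 h.2.1).2 h1
  refine le_of_sq_le_sq ?_ (by linarith)
  rw [dist_sq s i]
  nlinarith [mul_nonneg (sub_nonneg.2 h1.le) (sub_nonneg.2 h2.le)]

theorem dist_le_of_uniArc (hP : GeneralPosition P) (hD : IsYaoDigraph D) {s : Bool} {i : Fin 4}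
    {u a b : P} (h : OrNext D s i u a b) (hu : UniArc D a b) :
    dist a b ≤ √2 * (orCoord (!s) i b - orCoord (!s) i a) := by
  have h1 := h.2.2.1
  have h2 := (orCoord_not_lt hP hD s h.1 h.2.1).2 h1
  have h3 := uniArc_extent hP hD h hu
  refine le_of_sq_le_sq ?_ (mul_nonneg (Real.sqrt_nonneg 2) (by linarith))
  rw [dist_sq s i, mul_pow, Real.sq_sqrt (by norm_num)]
  nlinarith

/-- The length of the path with the given list of nodes. -/
def pathLength : List P → ℝ
  | [] => 0
  | [_] => 0
  | a :: b :: p => dist a b + pathLength (b :: p)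

/-- Telescoping: `f` is a potential whose increase pays for each edge. -/
theorem pathLength_le {R : P → P → Prop} {f : P → ℝ} (hR : ∀ a b, R a b → dist a b ≤ f b - f a)
    (p : List P) : ∀ {a b : P}, p.head? = some a → p.getLast? = some b → p.IsChain R →
      pathLength p ≤ f b - f a := by
  induction p with
  | nil => intro a b h; simp at h
  | cons c p ih =>
    intro a b ha hb hc
    obtain rfl : c = a := by simpa using ha
    cases p with
    | nil =>
      obtain rfl : c = b := by simpa using hb
      simp [pathLength]
    | cons d p =>
      rw [List.isChain_cons_cons] at hc
      have h1 := hR c d hc.1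
      have h2 := ih rfl (by simpa using hb) hc.2
      simp only [pathLength]
      linarith

theorem pathLength_append (p : List P) : ∀ {a : P} (q : List P), p.getLast? = some a →
    pathLength (p ++ q) = pathLength p + pathLength (a :: q) := by
  induction p with
  | nil => intro a q h; simp at h
  | cons c p ih =>
    intro a q h
    cases p with
    | nil =>
      obtain rfl : c = a := by simpa using h
      simp [pathLength]
    | cons d p =>
      have := ih q (a := a) (by simpa using h)
      simp only [List.cons_append, pathLength] at this ⊢
      rw [this, add_assoc]

theorem pathLength_reverse (p : List P) : pathLength p.reverse = pathLength p := by
  induction p with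
  | nil => rfl
  | cons c p ih =>
    cases p with
    | nil => rfl
    | cons d p =>
      rw [List.reverse_cons, pathLength_append _ (a := d) [c] (by simp), ih]
      simp only [pathLength]
      rw [dist_comm d c]; ring

theorem pathLength_nonneg : ∀ p : List P, 0 ≤ pathLength p
  | [] => le_rfl
  | [_] => le_rfl
  | _ :: b :: p => add_nonneg dist_nonneg (pathLength_nonneg (b :: p))

theorem segment_of_chain {s : Bool} {i : Fin 4} {u : P} (p : List P) :
    ∀ {v w : P}, p.head? = some v → p.getLast? = some w → p.IsChain (OrNext D s i u) →
      p.IsChain (Segment D s i u v w) := by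
  induction p with
  | nil => intro v w h; simp at h
  | cons c p ih =>
    intro v w hv hw hc
    obtain rfl : c = v := by simpa using hv
    cases p with
    | nil => exact List.isChain_singleton _
    | cons d p =>
      rw [List.isChain_cons_cons] at hc ⊢
      have hw' : (d :: p).getLast? = some w := by simpa using hw
      exact ⟨⟨hc.1, le_rfl, orCoord_le_of_chain _ rfl hw' hc.2⟩,
        (ih rfl hw' hc.2).imp fun a b h => ⟨h.1, h.2.1.trans hc.1.2.2.1.le, h.2.2⟩⟩

theorem le_of_chain {R : P → P → Prop} {f : P → ℝ} (hR : ∀ a b, R a b → f a ≤ f b)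
    (p : List P) : ∀ {a b : P}, p.head? = some a → p.getLast? = some b → p.IsChain R →
      f a ≤ f b := by
  induction p with
  | nil => intro a b h; simp at h
  | cons c p ih =>
    intro a b ha hb hc
    obtain rfl : c = a := by simpa using ha
    cases p with
    | nil =>
      obtain rfl : c = b := by simpa using hb
      exact le_rfl
    | cons d p =>
      rw [List.isChain_cons_cons] at hc
      exact (hR c d hc.1).trans (ih rfl (by simpa using hb) hc.2)

/-- The length of an anchor followed by a canonical path. -/
theorem anchor_path_le (hP : GeneralPosition P) (hD : IsYaoDigraph D) {i : Fin 4} {u v w : P}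
    {q : List P} (ha : IsAnchor D i u v) (hq : CanPath D i u v w q) :
    dist u v + pathLength q ≤ (3 + √2) * dist u w := by
  obtain ⟨hv, hw, hhead, hlast, s', hchain⟩ := (canPath_iff hP hD).1 hq
  obtain ⟨t, ⟨ht, hut⟩, -⟩ := hD.choice u i ⟨w, hw.2⟩
  have htm := fanMem_of_arc ht hut
  obtain ⟨s, hs⟩ : ∃ s, orCoord s i t ≤ orCoord s i v := by
    obtain rfl | ⟨s, hs⟩ := ha.uni_path hP hD htm hut
    · exact ⟨true, le_rfl⟩
    · exact ⟨s, hs.2.1.le⟩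
  have huni : ∀ a b, Segment D s i u v t a b → UniArc D a b := fun a b h =>
    ha.segment_uni hP hD htm hut h
  have hyt : orCoord (!s) i v ≤ orCoord (!s) i t := by
    by_contra hlt
    exact not_lt.2 hs ((orCoord_not_lt hP hD s htm hv).1 (not_le.1 hlt))
  -- On a uni-directional edge the rising coordinate gains more than the falling one loses, so the
  -- coordinate sum grows from `v` to `t`.
  have hvt : orCoord s i v + orCoord (!s) i v ≤ orCoord s i t + orCoord (!s) i t := by
    obtain ⟨l, h1, h2, h3⟩ := exists_segment_list hP htm v hv hs
    refine le_of_chain (f := fun p => orCoord s i p + orCoord (!s) i p) (fun a b hab => ?_) l h1 h2 h3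
    have := uniArc_extent hP hD hab.1 (huni a b hab)
    linarith
  obtain ⟨hux, huy, -⟩ := (fanMem_iff s).1 hw
  obtain ⟨hvx, hvy, -⟩ := (fanMem_iff s).1 hv
  obtain ⟨htx, hty, -⟩ := (fanMem_iff s).1 htm
  have hd1 := sub_le_dist s i u w
  have hd2 := sub_le_dist (!s) i u w
  have hnear := (frame hP hD s i).pp.near u t w hut htx hty hux huy
  have ht1 : orCoord s i t - orCoord s i u ≤ dist u w := by rcases hnear.1 with h | h <;> linarith
  have ht2 : orCoord (!s) i t - orCoord (!s) i u ≤ dist u w := by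
    rcases hnear.2 with h | h <;> linarith
  have hdv := dist_le_add s hvx.le hvy.le
  have h2 : 0 ≤ √2 := Real.sqrt_nonneg 2
  by_cases hss : s' = s
  · subst hss
    -- Up to `t` the edges are uni-directional and cost at most √2 times the rise; beyond `t` each
    -- costs at most the sum of its extents. The minimum and maxima glue the two rates at `t`.
    set f : P → ℝ := fun p => √2 * min (orCoord (!s') i p) (orCoord (!s') i t) +
      max (orCoord (!s') i p - orCoord (!s') i t) 0 + max (orCoord s' i t - orCoord s' i p) 0 with hf
    have hbefore : ∀ c, FanMem D i u c → orCoord s' i t ≤ orCoord s' i c →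
        f c = √2 * orCoord (!s') i c := by
      intro c hc hle
      have : orCoord (!s') i c ≤ orCoord (!s') i t := by
        by_contra hlt
        exact not_lt.2 hle ((orCoord_not_lt hP hD s' htm hc).1 (not_le.1 hlt))
      rw [hf]
      simp only
      rw [min_eq_left this, max_eq_right (by linarith), max_eq_right (by linarith)]; ring
    have hafter : ∀ c, FanMem D i u c → orCoord s' i c ≤ orCoord s' i t →
        f c = √2 * orCoord (!s') i t + (orCoord (!s') i c - orCoord (!s') i t) +
          (orCoord s' i t - orCoord s' i c) := by
      intro c hc hle
      have : orCoord (!s') i t ≤ orCoord (!s') i c := by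
        by_contra hlt
        exact not_lt.2 hle ((orCoord_not_lt hP hD s' hc htm).1 (not_le.1 hlt))
      rw [hf]
      simp only
      rw [min_eq_right this, max_eq_left (by linarith), max_eq_left (by linarith)]
    have hlen := pathLength_le (f := f) (fun a b hab => ?_) q hhead hlast
      (segment_of_chain q hhead hlast hchain)
    · rw [hbefore v hv hs] at hlen
      rcases le_total (orCoord s' i t) (orCoord s' i w) with h | h
      · rw [hbefore w hw h] at hlen
        have hm : √2 * (orCoord (!s') i w - orCoord (!s') i v) ≤ √2 * dist u w :=
          mul_le_mul_of_nonneg_left (by linarith) h2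
        nlinarith [dist_nonneg (x := u) (y := w)]
      · rw [hafter w hw h] at hlen
        have hm : √2 * (orCoord (!s') i t - orCoord (!s') i v) ≤ √2 * dist u w :=
          mul_le_mul_of_nonneg_left (by linarith) h2
        nlinarith [dist_nonneg (x := u) (y := w)]
    · rcases le_or_gt (orCoord s' i t) (orCoord s' i b) with h | h
      · rw [hbefore b hab.1.2.1 h, hbefore a hab.1.1 (h.trans hab.1.2.2.1.le)]
        have := dist_le_of_uniArc hP hD hab.1 (huni a b ⟨hab.1, hab.2.1, h⟩)
        linarith
      -- The fan member `t` cannot lie strictly between the consecutive members `a` and `b`, so no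
      -- edge straddles the change of rate.
      · have h' : orCoord s' i a ≤ orCoord s' i t := by
          by_contra hlt
          exact hab.1.2.2.2 t htm ⟨h, not_le.1 hlt⟩
        rw [hafter b hab.1.2.1 h.le, hafter a hab.1.1 h']
        have := dist_le_of_orNext hP hD hab.1
        linarith
  · obtain rfl : s' = !s := by cases s <;> cases s' <;> simp_all
    -- The path leads away from `t`, so nothing is known about its arcs; the sum of the extents
    -- suffices, even without the term √2.
    have hlen := pathLength_le (f := fun p => orCoord s i p - orCoord (!s) i p)
      (fun a b hab => ?_) q hhead hlast hchain
    · have h3 : 0 ≤ √2 * dist u w := mul_nonneg h2 dist_nonneg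
      nlinarith
    · have := dist_le_of_orNext hP hD hab
      rw [Bool.not_not] at this
      linarith

theorem OneStandard.length_le (hP : GeneralPosition P) (hD : IsYaoDigraph D) {u v : P}
    {p : List P} (h : OneStandard D u v p) : pathLength p ≤ (3 + √2) * dist u v := by
  obtain ⟨i, v', q, -, ha, hq, rfl⟩ := h
  rw [← List.singleton_append, pathLength_append [u] q (a := u) rfl]
  obtain ⟨q, rfl⟩ : ∃ q', q = v' :: q' := by
    cases q with
    | nil => simp [CanPath] at hq
    | cons c q => exact ⟨q, by simpa using hq.2.2.1⟩
  simpa [pathLength] using anchor_path_le hP hD ha hq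

/-- If the anchor is not selected, the 1-standard path back to `u` costs at most 3 + √2 times the
anchor, and anchor plus canonical path is bounded by `anchor_path_le`. -/
theorem TwoStandard.length_le (hP : GeneralPosition P) (hD : IsYaoDigraph D) {u v : P}
    {p : List P} (h : TwoStandard D u v p) : pathLength p ≤ (3 + √2) ^ 2 * dist u v := by
  have h2 : 0 ≤ √2 := Real.sqrt_nonneg 2
  obtain ⟨i, v', -, ha, ⟨-, h⟩ | ⟨-, q, r, hq, hr, rfl⟩⟩ := h
  · refine (h.length_le hP hD).trans (mul_le_mul_of_nonneg_right ?_ dist_nonneg)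
    nlinarith
  · have h1 := hr.length_le hP hD
    have h3 := anchor_path_le hP hD ha hq.reverse
    obtain ⟨j, w, r, -, -, -, rfl⟩ := hr
    rw [pathLength_reverse] at h3 ⊢
    rw [pathLength_append q _ hq.2.2.2.1, List.tail_cons]
    rw [dist_comm] at h1
    have h4 := pathLength_nonneg q
    calc pathLength q + pathLength (v' :: r) ≤ pathLength q + (3 + √2) * dist u v' := by linarith
      _ ≤ (3 + √2) * (dist u v' + pathLength q) := by nlinarith
      _ ≤ (3 + √2) * ((3 + √2) * dist u v) := mul_le_mul_of_nonneg_left h3 (by linarith)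
      _ = _ := by ring

theorem edgesLength_append (E F : List (P × P)) :
    edgesLength (E ++ F) = edgesLength E + edgesLength F := by
  simp [edgesLength]

theorem edgesLength_reverseEdges (E : List (P × P)) :
    edgesLength (reverseEdges E) = edgesLength E := by
  simp [edgesLength, reverseEdges, List.map_reverse, List.sum_reverse, Function.comp_def, dist_comm]

theorem Splice.length_le {B : P → P → List (P × P) → Prop} {K : ℝ}
    (hB : ∀ a b F, B a b F → edgesLength F ≤ K * dist a b) {p : List P} {E : List (P × P)}
    (h : Splice B p E) : edgesLength E ≤ K * pathLength p := by
  induction h with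
  | single a => simp [edgesLength, pathLength]
  | cons a b p E F hE _ ih =>
    rw [edgesLength_append, pathLength, mul_add]
    exact add_le_add (hB a b E hE) ih

/-- Kept edges cost a factor 1, dropped edges nothing, replaced edges the bound of the previous
level; connectedness plays no role. -/
theorem PrePath.length_le (hP : GeneralPosition P) (hD : IsYaoDigraph D) {H : SimpleGraph P}
    (d : ℕ) : ∀ {u v : P} {E : List (P × P)}, PrePath D H d u v E →
      edgesLength E ≤ (3 + √2) ^ (2 * d) * dist u v := by
  have h2 : 0 ≤ √2 := Real.sqrt_nonneg 2
  induction d with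
  | zero => intro u v E h; rw [PrePath] at h; exact h.elim
  | succ d ih =>
    intro u v E h
    rw [PrePath] at h
    obtain ⟨p, hp, hE⟩ := h
    have hK : 1 ≤ (3 + √2) ^ (2 * d) := one_le_pow₀ (by linarith)
    refine (Splice.length_le (K := (3 + √2) ^ (2 * d)) ?_ hE).trans ?_
    · rintro a b F (⟨-, rfl⟩ | ⟨-, -, -, h | h⟩ | ⟨-, -, rfl⟩)
      · simpa [edgesLength] using le_mul_of_one_le_left dist_nonneg hK
      · exact ih h
      · rw [← edgesLength_reverseEdges, dist_comm]
        exact ih h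
      · simpa [edgesLength] using mul_nonneg (by linarith) dist_nonneg
    · calc (3 + √2) ^ (2 * d) * pathLength p
          ≤ (3 + √2) ^ (2 * d) * ((3 + √2) ^ 2 * dist u v) :=
            mul_le_mul_of_nonneg_left (hp.length_le hP hD) (by linarith)
        _ = _ := by ring

/-! ### The spanner property -/

theorem H8_le_yaoGraph (hP : GeneralPosition P) (hD : IsYaoDigraph D) : H8 D ≤ yaoGraph D := by
  have key : ∀ a b : P, ((∃ i : Fin 4, SelectedAnchor D i a b) ∨
      ∃ (i : Fin 4) (u : P), ChosenCanonical D i u a b) → (yaoGraph D).Adj a b := by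
    rintro a b (⟨i, h⟩ | ⟨i, u, h⟩)
    · exact (h.isAnchor.fanMem hP hD).1
    · exact (((fanNext_iff hP hD).1 h.1).fanMem hP hD).1
  intro a b h
  rw [H8, SimpleGraph.fromRel_adj] at h
  exact h.2.elim (key a b) fun h => (key b a h).symm

/-- A bound for single edges is enough: each edge of a walk is replaced by its path, and the infimum
over walks is taken at the end. -/
theorem isSpanner_of_adj {t : ℝ} {H G : SimpleGraph P} (ht : 1 ≤ t) (hle : H ≤ G)
    (h : ∀ u v : P, G.Adj u v → ∃ E, IsPathIn H u v E ∧ edgesLength E ≤ t * dist u v) :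
    IsSpanner t H G := by
  refine ⟨ht, hle, fun u v => ?_⟩
  have key : ∀ {u v : P} (w : G.Walk u v), ∃ E, IsPathIn H u v E ∧
      edgesLength E ≤ t * edgesLength (w.darts.map fun e => e.toProd) := by
    intro u v w
    induction w with
    | nil => exact ⟨[], ⟨SimpleGraph.Walk.nil, rfl⟩, by simp [edgesLength]⟩
    | cons hadj w ih =>
      obtain ⟨F, ⟨w2, rfl⟩, hF⟩ := ih
      obtain ⟨E, ⟨w1, rfl⟩, hE⟩ := h _ _ hadj
      refine ⟨_, ⟨w1.append w2, rfl⟩, ?_⟩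
      rw [SimpleGraph.Walk.darts_append, List.map_append, edgesLength_append,
        SimpleGraph.Walk.darts_cons, List.map_cons, ← List.singleton_append, edgesLength_append,
        mul_add]
      exact add_le_add (by simpa [edgesLength] using hE) hF
  unfold graphDist
  rw [ENNReal.mul_iInf_of_ne (by simpa using by linarith) ENNReal.ofReal_ne_top]
  refine le_iInf fun w => ?_
  obtain ⟨_, ⟨w', rfl⟩, hE⟩ := key w
  rw [← ENNReal.ofReal_mul (by linarith)]
  exact (iInf_le _ w').trans (ENNReal.ofReal_le_ofReal hE)

end YaoSpanner

end

theorem mainTheorem3 (P : Finset YaoSpanner.Pt) (hP : YaoSpanner.GeneralPosition P)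
    (D : P → P → Prop) (hD : YaoSpanner.IsYaoDigraph D) :
    (∀ u v : P, (YaoSpanner.yaoGraph D).Adj u v →
      ∃ E : List (P × P),
        (YaoSpanner.IsStandardPath D (YaoSpanner.H8 D) 3 u v E ∨
          YaoSpanner.IsStandardPath D (YaoSpanner.H8 D) 3 v u E) ∧
        YaoSpanner.edgesLength E ≤ (3 + Real.sqrt 2) ^ 6 * dist u v) ∧
    YaoSpanner.IsSpanner ((3 + Real.sqrt 2) ^ 6) (YaoSpanner.H8 D) (YaoSpanner.yaoGraph D) := by
  have main : ∀ u v : P, (YaoSpanner.yaoGraph D).Adj u v →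
      ∃ E : List (P × P),
        (YaoSpanner.IsStandardPath D (YaoSpanner.H8 D) 3 u v E ∨
          YaoSpanner.IsStandardPath D (YaoSpanner.H8 D) 3 v u E) ∧
        YaoSpanner.edgesLength E ≤ (3 + Real.sqrt 2) ^ 6 * dist u v := by
    intro u v h
    obtain ⟨E, hE⟩ | ⟨E, hE⟩ := YaoSpanner.exists_standardPath hP hD h
    · exact ⟨E, Or.inl hE, hE.1.length_le hP hD 3⟩
    · exact ⟨E, Or.inr hE, dist_comm v u ▸ hE.1.length_le hP hD 3⟩
  refine ⟨main, YaoSpanner.isSpanner_of_adj (one_le_pow₀ ?_) (YaoSpanner.H8_le_yaoGraph hP hD) ?_⟩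
  · linarith [Real.sqrt_nonneg 2]
  · intro u v h
    obtain ⟨E, hE | hE, hlen⟩ := main u v h
    · exact ⟨E, hE.2, hlen⟩
    · exact ⟨_, hE.2.reverse, by rwa [YaoSpanner.edgesLength_reverseEdges]⟩
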